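/- Let $M,N\ge 0$ be integers and $\beta\in\mathbb C$. For $t\in\mathbb C$ let $\mathcal F$ be the Fock space with basis $|n\rangle$, $n\ge 0$, and dual basis $\langle n|$, with operators $$B|n\rangle=|n-1\rangle\ (B|0\rangle=0),\qquad B^\dagger|n\rangle=(1-t^{n+1})|n+1\rangle,\qquad t^{\mathcal N}|n\rangle=t^n|n\rangle .$$ On $\mathbb C^2\otimes\mathcal F^{\otimes M}$ consider, for $1\le j\le M$, $$\mathcal L_j(v)=\begin{pmatrix}1-\beta v\,t^{\mathcal N_j}& vB_j^\dagger\\ B_j& v\end{pmatrix},$$ where the matrix refers to the basis $|0\rangle,|1\rangle$ of the auxiliary space $\mathbb C^2$ (rows are labelled by bras, columns by kets) and the subscript $j$ on the entries means that they act on the $j$-th factor $\mathcal F$. Put $$\mathcal T(v)=\mathcal L_M(v)\cdots\mathcal L_2(v)\mathcal L_1(v)=\begin{pmatrix}\mathcal A(v)&\mathcal B(v)\\ \mathcal C(v)&\mathcal D(v)\end{pmatrix},\qquad |\Omega\rangle=|0\rangle^{\otimes M},\quad \langle\Omega|=\langle 0|^{\otimes M}.$$ From now on let $t=-1$. Let $m=(m_1,\dots,m_M)$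 be a particle configuration with $m_1+\cdots+m_M=N$, let $|m\rangle=|m_1\rangle\otimes\cdots\otimes|m_M\rangle$ and $\langle m|=\langle m_1|\otimes\cdots\otimes\langle m_M|$, and let $x=(x_1\ge\cdots\ge x_N)=(M^{m_M},\dots,1^{m_1})$ be the weakly decreasing list of the positions of the particles. Assume that $\lambda_j=x_j-N+j-1$ $(1\le j\le N)$ defines a partition $\lambda=(\lambda_1\ge\cdots\ge\lambda_N\ge0)$; this means that all $m_i\in\{0,1\}$, and then $\lambda\subset(M-N)^N$. Let $\lambda^\vee_j=M-N-\lambda_{N+1-j}$. Let $v_1,\dots,v_N\in\mathbb C$ satisfy $v_j\ne0$ and $v_j^{-1}\neq\beta$, and put $z_j=(v_j^{-1}-\beta)^{-1}$. Then $$\langle m|\,\mathcal B(v_1)\cdots\mathcal B(v_N)\,|\Omega\rangle=\frac{2^N\prod_{j=1}^N z_j\prod_{1\le j<k\le N}(z_j+z_k+2\beta z_jz_k)}{\prod_{j=1}^N(1+\beta z_j)^M}\;s_\lambda(z_1,\dots,z_N)$$ and $$\langle\Omega|\,\mathcal C(v_1)\cdots\mathcal C(v_N)\,|m\rangle=\frac{\prod_{1\le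 j<k\le N}(z_j+z_k+2\beta z_jz_k)}{\prod_{j=1}^N(1+\beta z_j)^{M-1}}\;s_{\lambda^\vee}(z_1,\dots,z_N),$$ where the Schur polynomial $s_\mu$ of a partition $\mu=(\mu_1,\dots,\mu_N)$ is the polynomial $$s_\mu(z_1,\dots,z_N)=\frac{\det\bigl(z_j^{\mu_k+N-k}\bigr)_{1\le j,k\le N}}{\prod_{1\le j<k\le N}(z_j-z_k)} .$$ -/

import Mathlib

noncomputable section

open scoped BigOperators

namespace SixVertex

/-! ## The `t`-deformed boson Fock space -/

/-- The Fock space with basis `|n⟩`, `n ≥ 0`. -/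
abbrev Fock : Type := ℕ →₀ ℂ

/-- The annihilation operator: `B|n⟩ = |n-1⟩` for `n ≥ 1`, and `B|0⟩ = 0`. -/
def annihilation : Module.End ℂ Fock :=
  Finsupp.linearCombination ℂ fun n : ℕ =>
    if n = 0 then (0 : Fock) else Finsupp.single (n - 1) 1

/-- The creation operator: `B†|n⟩ = (1 - t^(n+1)) |n+1⟩`. -/
def creation (t : ℂ) : Module.End ℂ Fock :=
  Finsupp.linearCombination ℂ fun n : ℕ => Finsupp.single (n + 1) (1 - t ^ (n + 1))

/-- The operator `t^N`, where `N|n⟩ = n|n⟩` is the number operator: `t^N|n⟩ = t^n |n⟩`. -/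
def tPowNumber (t : ℂ) : Module.End ℂ Fock :=
  Finsupp.linearCombination ℂ fun n : ℕ => Finsupp.single n (t ^ n)

/-! ## The chain of `M` sites

Sites are indexed by `Fin M`; the element `i : Fin M` stands for the site number `i + 1`. -/

/-- The tensor product of `M` copies of the Fock space, realised on its product basis
`|n_1⟩ ⊗ ⋯ ⊗ |n_M⟩`, which is indexed by the functions `n : Fin M → ℕ`. -/
abbrev Chain (M : ℕ) : Type := (Fin M → ℕ) →₀ ℂ

/-- The basis vector `|n_1⟩ ⊗ ⋯ ⊗ |n_M⟩`. -/
def ket {M : ℕ} (n : Fin M → ℕ) : Chain M := Finsupp.single n 1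

/-- The matrix element `⟨m|X|n⟩` of an operator on the chain. -/
def matrixElement {M : ℕ} (m : Fin M → ℕ) (X : Module.End ℂ (Chain M)) (n : Fin M → ℕ) : ℂ :=
  (X (ket n)) m

/-- The operator `1 ⊗ ⋯ ⊗ A ⊗ ⋯ ⊗ 1` with `A` acting on the site `i`: the basis vector `|n⟩` is
sent to the sum over `k` of `⟨k|A|n_i⟩` times the basis vector with `n_i` replaced by `k`. -/
def atSite {M : ℕ} (i : Fin M) (A : Module.End ℂ Fock) : Module.End ℂ (Chain M) :=
  Finsupp.linearCombination ℂ fun n : Fin M → ℕ =>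
    Finsupp.mapDomain (fun k : ℕ => Function.update n i k) (A (Finsupp.single (n i) 1))

/-- The `L`-operator at the site `i`, as a `2 × 2` matrix over the two-dimensional auxiliary
space whose entries are operators on the chain; rows are labelled by the auxiliary bra and
columns by the auxiliary ket. -/
def Lop (t β v : ℂ) {M : ℕ} (i : Fin M) : Matrix (Fin 2) (Fin 2) (Module.End ℂ (Chain M)) :=
  !![1 - (β * v) • atSite i (tPowNumber t), v • atSite i (creation t);
     atSite i annihilation,                 v • (1 : Module.End ℂ (Chain M))]

/-- The monodromy matrix. The site `1` acts first on the auxiliary space, so that as a matrix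
product it is `L_M(v) ⋯ L_2(v) L_1(v)`. -/
def monodromy (t β v : ℂ) (M : ℕ) : Matrix (Fin 2) (Fin 2) (Module.End ℂ (Chain M)) :=
  ((List.ofFn fun i : Fin M => Lop t β v i).reverse).prod

/-- The entry `⟨0|T(v)|1⟩` of the monodromy matrix. -/
def Bop (t β : ℂ) (M : ℕ) (v : ℂ) : Module.End ℂ (Chain M) := monodromy t β v M 0 1

/-- The entry `⟨1|T(v)|0⟩` of the monodromy matrix. -/
def Cop (t β : ℂ) (M : ℕ) (v : ℂ) : Module.End ℂ (Chain M) := monodromy t β v M 1 0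

/-- The wavefunction `⟨m| B(v_1) ⋯ B(v_N) |Ω⟩`, where `Ω` is the empty chain. -/
def wavefunction (t β : ℂ) {M N : ℕ} (v : Fin N → ℂ) (m : Fin M → ℕ) : ℂ :=
  matrixElement m (List.ofFn fun j => Bop t β M (v j)).prod 0

/-- The dual wavefunction `⟨Ω| C(v_1) ⋯ C(v_N) |m⟩`. -/
def dualWavefunction (t β : ℂ) {M N : ℕ} (v : Fin N → ℂ) (m : Fin M → ℕ) : ℂ :=
  matrixElement 0 (List.ofFn fun j => Cop t β M (v j)).prod m

/-! ## Configurations and Young diagrams -/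

/-- `x = (M^{m_M}, …, 1^{m_1})`: `x` is the weakly decreasing list, of length `N`, of the
positions of the particles of the configuration `m`, with multiplicity. -/
structure IsPositions {M N : ℕ} (m : Fin M → ℕ) (x : Fin N → ℕ) : Prop where
  antitone : Antitone x
  one_le : ∀ j, 1 ≤ x j
  le : ∀ j, x j ≤ M
  count : ∀ i : Fin M, m i = (Finset.univ.filter fun j => x j = (i : ℕ) + 1).card

/-- `λ` is a partition with `λ_j = x_j - N + j - 1` for `1 ≤ j ≤ N` (here `j` is zero-based, so
that the one-based index is `j + 1`). -/
structure IsShiftOf {N : ℕ} (lam x : Fin N → ℕ) : Prop where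
  antitone : Antitone lam
  eq : ∀ j : Fin N, (lam j : ℤ) = (x j : ℤ) - N + ((j : ℤ) + 1) - 1

/-- The dual partition `λ^∨_j = M - N - λ_{N+1-j}` in the rectangle `(M-N)^N`. -/
def dualPartition (M : ℕ) {N : ℕ} (lam : Fin N → ℕ) : Fin N → ℕ :=
  fun j => M - N - lam j.rev

/-! ## Schur polynomials -/

open MvPolynomial in
/-- The Vandermonde product `∏_{j<k} (X_j - X_k)`. -/
def vandermondeProd (N : ℕ) : MvPolynomial (Fin N) ℂ :=
  ∏ j : Fin N, ∏ k ∈ Finset.Ioi j, (X j - X k)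

open MvPolynomial in
/-- The alternant `det (X_j ^ (λ_k + N - k))`, with `1 ≤ j, k ≤ N` (the indices in the code are
zero-based). -/
def alternant {N : ℕ} (lam : Fin N → ℕ) : MvPolynomial (Fin N) ℂ :=
  Matrix.det (Matrix.of fun j k : Fin N =>
    (X j : MvPolynomial (Fin N) ℂ) ^ (lam k + (N - ((k : ℕ) + 1))))

open MvPolynomial in
lemma irreducible_X_sub_X {N : ℕ} {j k : Fin N} (h : j ≠ k) :
    Irreducible (X j - X k : MvPolynomial (Fin N) ℂ) := by
  have hc : coeff (Finsupp.single j 1) (X j - X k : MvPolynomial (Fin N) ℂ) = 1 := by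
    simp [coeff_X, Finsupp.single_left_inj, h.symm]
  have hdeg : (X j - X k : MvPolynomial (Fin N) ℂ).totalDegree = 1 := by
    apply le_antisymm
    · exact (totalDegree_sub _ _).trans (by simp)
    · have hm : Finsupp.single j 1 ∈ (X j - X k : MvPolynomial (Fin N) ℂ).support := by
        rw [mem_support_iff, hc]; exact one_ne_zero
      simpa using le_totalDegree hm
  refine irreducible_of_totalDegree_eq_one hdeg ?_
  intro x hx
  have := hx (Finsupp.single j 1)
  rw [hc] at this
  exact isUnit_of_dvd_one this

open MvPolynomial in
lemma not_X_sub_X_dvd {N : ℕ} {i j k l : Fin N} (hij : i < j) (hkl : k < l)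
    (hne : (i, j) ≠ (k, l)) :
    ¬ (X i - X j : MvPolynomial (Fin N) ℂ) ∣ X k - X l := by
  rintro ⟨q, hq⟩
  have := congrArg (eval fun a : Fin N => (((if a = j then i else a) : Fin N) : ℂ)) hq
  simp only [map_sub, map_mul, eval_X, if_neg hij.ne, if_true, sub_self, zero_mul] at this
  have h2 : (if k = j then i else k) = (if l = j then i else l) := by
    apply Fin.ext
    exact_mod_cast sub_eq_zero.mp this
  apply hne
  grind

open MvPolynomial in
lemma X_sub_X_dvd_alternant {N : ℕ} (lam : Fin N → ℕ) {i j : Fin N} (h : i ≠ j) :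
    (X i - X j : MvPolynomial (Fin N) ℂ) ∣ alternant lam := by
  rw [← Ideal.mem_span_singleton, ← Ideal.Quotient.eq_zero_iff_mem, alternant, RingHom.map_det]
  apply Matrix.det_zero_of_row_eq h
  have : Ideal.Quotient.mk (Ideal.span {(X i - X j : MvPolynomial (Fin N) ℂ)}) (X i) =
      Ideal.Quotient.mk _ (X j) := by
    rw [Ideal.Quotient.eq]; exact Ideal.mem_span_singleton_self _
  funext k
  simp [RingHom.mapMatrix_apply, this]

/-- The Vandermonde product divides the alternant. -/
lemma vandermondeProd_dvd_alternant {N : ℕ} (lam : Fin N → ℕ) :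
    vandermondeProd N ∣ alternant lam := by
  rw [vandermondeProd, Finset.prod_sigma']
  apply Finset.prod_dvd_of_isRelPrime
  · rintro ⟨i, j⟩ hij ⟨k, l⟩ hkl hne
    simp only [Finset.coe_sigma, Set.mem_sigma_iff, Finset.coe_univ, Set.mem_univ, true_and,
      Finset.coe_Ioi, Set.mem_Ioi] at hij hkl
    refine (irreducible_X_sub_X hij.ne).isRelPrime_iff_not_dvd.mpr (not_X_sub_X_dvd hij hkl ?_)
    rintro ⟨⟩
    exact hne rfl
  · rintro ⟨i, j⟩ hij
    simp only [Finset.mem_sigma, Finset.mem_univ, true_and, Finset.mem_Ioi] at hij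
    exact X_sub_X_dvd_alternant lam hij.ne

/-- The Schur polynomial `s_λ`: the quotient of the alternant by the Vandermonde product, as a
polynomial in `N` variables. -/
def schurPoly {N : ℕ} (lam : Fin N → ℕ) : MvPolynomial (Fin N) ℂ :=
  Classical.choose (vandermondeProd_dvd_alternant lam)

/-- The defining property of the Schur polynomial; it determines it, since the Vandermonde
product is a non-zero element of an integral domain. -/
lemma vandermondeProd_mul_schurPoly {N : ℕ} (lam : Fin N → ℕ) :
    vandermondeProd N * schurPoly lam = alternant lam :=
  (Classical.choose_spec (vandermondeProd_dvd_alternant lam)).symm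

/-- The value `s_λ(z_1, …, z_N)`. -/
def schur {N : ℕ} (lam : Fin N → ℕ) (z : Fin N → ℂ) : ℂ :=
  MvPolynomial.eval z (schurPoly lam)

end SixVertex

end

noncomputable section

open scoped BigOperators

namespace SixVertex

section

/-! ## Operators at a site -/

variable {M : ℕ}

/-! At `t = -1` the `L`-operators satisfy an exchange relation with a free-fermionic `R`-matrix
(`braidMatrix_mul_listMonodromy`). Hence, for parameters with nonzero pairwise sums, the operators
`B(v_j)` commute, and moving the diagonal entry past them costs factors `(u+v)/(u-v)` plus exchange
terms.

Splitting off site `i` gives `B(v) = v (B'(v) + c A'(v))`, with `c` the creation operator at `i`,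
commuting with the rest and satisfying `c² = 0`. A Bethe vector is therefore of first order in `c`
(`commProd_apply_eq_add`): either no particle sits at `i`, or one does and a single `v_j` is
removed, weighted by its scattering factors. Since `∏_{j<k} (v_j+v_k)/(v_j-v_k)` is antisymmetric,
this recursion is the Laplace expansion of that product times a determinant with entries `2
v_i^{x_j} (1-β v_i)^{M-x_j}` (`commProd_sitesFrom`). The operators `C` are treated by transposition
(`dual_commProd_sitesBelow`).

With `z = v/(1-βv)` the determinants become alternants, and the scattering product times the
Vandermonde product in `z` is `∏ (z_j+z_k+2β z_j z_k)`. This argument divides by `v_j-v_k` and needs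
`v_j+v_k ≠ 0`; continuity along a line through `v` removes both restrictions
(`eq_of_eq_on_generic`). -/

lemma atSite_single (i : Fin M) (A : Module.End ℂ Fock) (n : Fin M → ℕ) (a : ℂ) :
    atSite i A (Finsupp.single n a) = a •
      Finsupp.mapDomain (fun k : ℕ => Function.update n i k) (A (Finsupp.single (n i) 1)) := by
  simp [atSite]

lemma annihilation_site_single (i : Fin M) (n : Fin M → ℕ) (a : ℂ) :
    atSite i annihilation (Finsupp.single n a) =
      if n i = 0 then 0 else Finsupp.single (Function.update n i (n i - 1)) a := by
  rw [atSite_single]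
  split_ifs with h <;> simp [annihilation, h, Finsupp.mapDomain_single]

lemma creation_site_single (t : ℂ) (i : Fin M) (n : Fin M → ℕ) (a : ℂ) :
    atSite i (creation t) (Finsupp.single n a) =
      Finsupp.single (Function.update n i (n i + 1)) (a * (1 - t ^ (n i + 1))) := by
  rw [atSite_single, creation, Finsupp.linearCombination_single, one_smul,
    Finsupp.mapDomain_single, Finsupp.smul_single, smul_eq_mul]

lemma tPowNumber_site_single (t : ℂ) (i : Fin M) (n : Fin M → ℕ) (a : ℂ) :
    atSite i (tPowNumber t) (Finsupp.single n a) = Finsupp.single n (a * t ^ n i) := by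
  rw [atSite_single]
  simp [tPowNumber, Finsupp.mapDomain_single]

/-- This relation and the next three are all that the exchange relation uses about a single site. -/
lemma annihilation_mul_creation (i : Fin M) :
    atSite i annihilation * atSite i (creation (-1)) = 1 + atSite i (tPowNumber (-1)) := by
  refine Finsupp.lhom_ext fun n a => ?_
  simp only [Module.End.mul_apply, LinearMap.add_apply, Module.End.one_apply,
    annihilation_site_single, creation_site_single, tPowNumber_site_single]
  simp only [Function.update_self, Nat.add_eq_zero_iff, one_ne_zero, and_false, if_false,
    Nat.add_sub_cancel, Function.update_idem, Function.update_eq_self, ← Finsupp.single_add]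
  congr 1
  ring

lemma creation_mul_annihilation (i : Fin M) :
    atSite i (creation (-1)) * atSite i annihilation = 1 - atSite i (tPowNumber (-1)) := by
  refine Finsupp.lhom_ext fun n a => ?_
  simp only [Module.End.mul_apply, LinearMap.sub_apply, Module.End.one_apply,
    annihilation_site_single, tPowNumber_site_single]
  split_ifs with h
  · simp [h]
  · obtain ⟨k, hk⟩ := Nat.exists_eq_succ_of_ne_zero h
    rw [creation_site_single]
    have : Function.update n i (k + 1) = n := by
      rw [← Nat.succ_eq_add_one, ← hk, Function.update_eq_self]
    simp only [Function.update_self, Function.update_idem, hk, Nat.succ_eq_add_one,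
      Nat.add_sub_cancel, this, ← Finsupp.single_sub]
    congr 1
    ring

lemma tPowNumber_mul_annihilation (i : Fin M) :
    atSite i (tPowNumber (-1)) * atSite i annihilation =
      -(atSite i annihilation * atSite i (tPowNumber (-1))) := by
  refine Finsupp.lhom_ext fun n a => ?_
  simp only [Module.End.mul_apply, LinearMap.neg_apply, annihilation_site_single,
    tPowNumber_site_single]
  split_ifs with h
  · simp
  · obtain ⟨k, hk⟩ := Nat.exists_eq_succ_of_ne_zero h
    simp only [tPowNumber_site_single, Function.update_self, hk, Nat.succ_eq_add_one,
      Nat.add_sub_cancel, ← Finsupp.single_neg]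
    congr 1
    ring

lemma tPowNumber_mul_creation (i : Fin M) :
    atSite i (tPowNumber (-1)) * atSite i (creation (-1)) =
      -(atSite i (creation (-1)) * atSite i (tPowNumber (-1))) := by
  refine Finsupp.lhom_ext fun n a => ?_
  simp only [Module.End.mul_apply, LinearMap.neg_apply, creation_site_single,
    tPowNumber_site_single, Function.update_self, ← Finsupp.single_neg]
  congr 1
  ring

/-- Of the consecutive exponents `n+1`, `n+2` one is even, so one factor `1 - (-1)^k` vanishes. This
exclusion principle truncates the Bethe vectors at first order. -/
lemma creation_mul_creation (i : Fin M) :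
    atSite i (creation (-1)) * atSite i (creation (-1)) = 0 := by
  refine Finsupp.lhom_ext fun n a => ?_
  simp only [Module.End.mul_apply, creation_site_single, LinearMap.zero_apply,
    Function.update_self, Finsupp.single_eq_zero]
  rcases neg_one_pow_eq_or ℂ (n i) with h | h <;> simp [pow_succ, h]

lemma commute_atSite {i j : Fin M} (h : i ≠ j) (A B : Module.End ℂ Fock) :
    Commute (atSite i A) (atSite j B) := by
  have key : ∀ (i j : Fin M), i ≠ j → ∀ (A B : Module.End ℂ Fock) (n : Fin M → ℕ),
      atSite i A (atSite j B (Finsupp.single n 1)) =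
        (B (Finsupp.single (n j) 1)).sum fun l b => (A (Finsupp.single (n i) 1)).sum fun k a =>
          Finsupp.single (Function.update (Function.update n j l) i k) (a * b) := by
    intro i j h A B n
    rw [atSite_single, one_smul, Finsupp.mapDomain, map_finsuppSum]
    refine Finsupp.sum_congr fun l _ => ?_
    rw [atSite_single, Finsupp.mapDomain, Finsupp.smul_sum, Function.update_of_ne h]
    refine Finsupp.sum_congr fun k _ => ?_
    simp [mul_comm]
  refine Finsupp.lhom_ext' fun n => LinearMap.ext_ring ?_
  simp only [LinearMap.comp_apply, Finsupp.lsingle_apply, Module.End.mul_apply]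
  rw [key i j h, key j i h.symm, Finsupp.sum_comm]
  refine Finsupp.sum_congr fun k _ => Finsupp.sum_congr fun l _ => ?_
  rw [Function.update_comm h, mul_comm]

lemma creation_site_apply_of_eq_zero {i : Fin M} {m : Fin M → ℕ} (hm : m i = 0) (w : Chain M) :
    atSite i (creation (-1)) w m = 0 := by
  induction w using Finsupp.induction_linear with
  | zero => simp
  | add f g hf hg => simp [hf, hg]
  | single n a =>
    rw [creation_site_single, Finsupp.single_apply, if_neg]
    rintro rfl
    simp at hm

/-- The factor `1 - (-1)^1 = 2`, once per particle, is the source of `2^N` in the first formula. -/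
lemma creation_site_apply_of_eq_one {i : Fin M} {m : Fin M → ℕ} (hm : m i = 1) (w : Chain M) :
    atSite i (creation (-1)) w m = 2 * w (Function.update m i 0) := by
  induction w using Finsupp.induction_linear with
  | zero => simp
  | add f g hf hg => simp [hf, hg, mul_add]
  | single n a =>
    rw [creation_site_single, Finsupp.single_apply, Finsupp.single_apply]
    by_cases h : n = Function.update m i 0
    · subst h
      simp only [Function.update_self, Function.update_idem, zero_add, ← hm,
        Function.update_eq_self, if_true]
      rw [hm]; ring
    · rw [if_neg h, if_neg, mul_zero]
      intro h'
      apply h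
      have h0 : n i = 0 := by simpa [hm] using congrFun h' i
      rw [← h', Function.update_idem, ← h0, Function.update_eq_self]

lemma annihilation_site_apply {i : Fin M} {m : Fin M → ℕ} (hm : m i = 1) (w : Chain M) :
    atSite i annihilation w (Function.update m i 0) = w m := by
  induction w using Finsupp.induction_linear with
  | zero => simp
  | add f g hf hg => simp [hf, hg]
  | single n a =>
    rw [annihilation_site_single, Finsupp.single_apply]
    by_cases h : n = m
    · subst h
      simp [hm]
    · rw [if_neg h]
      split_ifs with h0
      · simp
      · rw [Finsupp.single_apply, if_neg]
        intro h'
        apply h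
        -- The subtraction is truncated; `h0` rules out an empty site.
        have h1 : n i - 1 = 0 := by simpa using congrFun h' i
        have h2 : n i = 1 := by omega
        funext j
        by_cases hj : j = i
        · rw [hj, h2, hm]
        · simpa [hj] using congrFun h' j

/-! ## Monodromy matrices over a list of sites -/

/-- The product of the `L`-operators over a list of sites. -/
def listMonodromy (β : ℂ) (l : List (Fin M)) (v : ℂ) :
    Matrix (Fin 2) (Fin 2) (Module.End ℂ (Chain M)) :=
  (l.map (Lop (-1) β v)).prod

lemma monodromy_eq_listMonodromy (β v : ℂ) :
    monodromy (-1) β v M = listMonodromy β (List.finRange M).reverse v := by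
  rw [monodromy, listMonodromy, List.map_reverse, List.ofFn_eq_map]

lemma listMonodromy_cons (β : ℂ) (i : Fin M) (l : List (Fin M)) (v : ℂ) :
    listMonodromy β (i :: l) v = Lop (-1) β v i * listMonodromy β l v := by
  simp [listMonodromy]

lemma listMonodromy_concat (β : ℂ) (i : Fin M) (l : List (Fin M)) (v : ℂ) :
    listMonodromy β (l ++ [i]) v = listMonodromy β l v * Lop (-1) β v i := by
  simp [listMonodromy]

lemma commute_Lop_of_forall {i : Fin M} {X : Module.End ℂ (Chain M)}
    (h : ∀ A, Commute X (atSite i A)) (t β v : ℂ) (a b : Fin 2) :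
    Commute X (Lop t β v i a b) := by
  fin_cases a <;> fin_cases b
  · exact Commute.sub_right (R := Module.End ℂ (Chain M)) (Commute.one_right X)
      ((h (tPowNumber t)).smul_right (β * v))
  · exact (h _).smul_right v
  · exact h _
  · exact (Commute.one_right X).smul_right v

lemma commute_atSite_listMonodromy {i : Fin M} {l : List (Fin M)} (hi : i ∉ l)
    (A : Module.End ℂ Fock) (β v : ℂ) (a b : Fin 2) :
    Commute (atSite i A) (listMonodromy β l v a b) := by
  induction l generalizing a b with
  | nil =>
    simp only [listMonodromy, List.map_nil, List.prod_nil, Matrix.one_apply]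
    split_ifs
    exacts [Commute.one_right _, Commute.zero_right _]
  | cons j l ih =>
    simp only [List.mem_cons, not_or] at hi
    rw [listMonodromy_cons, Matrix.mul_apply]
    exact Commute.sum_right _ _ _ fun c _ => (commute_Lop_of_forall
      (fun B => commute_atSite hi.1 A B) _ _ _ _ _).mul_right (ih hi.2 _ _)

/-! ## The exchange relations -/

/-- The tensor product of two `2 × 2` matrices over a ring. -/
def tensor {R : Type*} [Ring R] (P Q : Matrix (Fin 2) (Fin 2) R) :
    Matrix (Fin 2 × Fin 2) (Fin 2 × Fin 2) R :=
  fun p q => P p.1 q.1 * Q p.2 q.2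

/-- The free-fermionic `R`-matrix, composed with the flip. -/
def braidMatrix (R : Type*) [Ring R] [Algebra ℂ R] (u v : ℂ) :
    Matrix (Fin 2 × Fin 2) (Fin 2 × Fin 2) R :=
  fun p q => algebraMap ℂ R <|
    if p = q then (if p = (0, 1) then 2 * v else if p = (1, 0) then 2 * u else u + v)
    else if p = (0, 1) ∧ q = (1, 0) then u - v
    else if p = (1, 0) ∧ q = (0, 1) then v - u else 0

lemma tensor_mul_tensor_of_commute {R : Type*} [Ring R] {P P' Q Q' : Matrix (Fin 2) (Fin 2) R}
    (h : ∀ a b c d, Commute (Q a b) (P' c d)) : 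
    tensor (P * P') (Q * Q') = tensor P Q * tensor P' Q' := by
  ext ⟨a, b⟩ ⟨c, d⟩
  simp only [tensor, Matrix.mul_apply, Fintype.sum_prod_type, Finset.sum_mul_sum]
  refine Finset.sum_congr rfl fun e _ => Finset.sum_congr rfl fun f _ => ?_
  rw [mul_assoc, ← mul_assoc (P' e c), ← (h b f e c).eq]
  simp only [mul_assoc]

/-- In each of the sixteen entries the four relations bring both sides to a common order of the
generators; what remains is an identity of scalar coefficients. -/
lemma braidMatrix_mul_tensor {R : Type*} [Ring R] [Algebra ℂ R] {b c q : R} (h1 : b * c = 1 + q)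
    (h2 : c * b = 1 - q) (h3 : q * b = -(b * q)) (h4 : q * c = -(c * q)) (β u v : ℂ) :
    braidMatrix R u v * tensor !![1 - (β * u) • q, u • c; b, u • (1 : R)]
        !![1 - (β * v) • q, v • c; b, v • (1 : R)] =
      tensor !![1 - (β * v) • q, v • c; b, v • (1 : R)]
        !![1 - (β * u) • q, u • c; b, u • (1 : R)] * braidMatrix R u v := by
  ext1 ⟨p1, p2⟩ ⟨q1, q2⟩
  fin_cases p1 <;> fin_cases p2 <;> fin_cases q1 <;> fin_cases q2 <;>
    simp [Matrix.mul_apply, Fintype.sum_prod_type, braidMatrix, tensor,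
      Algebra.algebraMap_eq_smul_one, sub_mul, mul_sub, h1, h2, h3, h4, -neg_sub] <;>
    module

lemma braidMatrix_mul_Lop (β u v : ℂ) (i : Fin M) :
    braidMatrix _ u v * tensor (Lop (-1) β u i) (Lop (-1) β v i) =
      tensor (Lop (-1) β v i) (Lop (-1) β u i) * braidMatrix _ u v :=
  braidMatrix_mul_tensor (annihilation_mul_creation i) (creation_mul_annihilation i)
    (tPowNumber_mul_annihilation i) (tPowNumber_mul_creation i) β u v

/-- The train argument: operators at distinct sites commute, so the tensor product factors site by
site and the `R`-matrix is carried through one site at a time. -/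
lemma braidMatrix_mul_listMonodromy (β u v : ℂ) {l : List (Fin M)} (hl : l.Nodup) :
    braidMatrix _ u v * tensor (listMonodromy β l u) (listMonodromy β l v) =
      tensor (listMonodromy β l v) (listMonodromy β l u) * braidMatrix _ u v := by
  induction l with
  | nil =>
    have : tensor (1 : Matrix (Fin 2) (Fin 2) (Module.End ℂ (Chain M))) 1 = 1 := by
      ext1 ⟨a, b⟩ ⟨c, d⟩
      simp only [tensor, Matrix.one_apply, Prod.mk.injEq]
      split_ifs <;> simp_all
    simp [listMonodromy, this]
  | cons i l ih =>
    rw [List.nodup_cons] at hl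
    have hcomm : ∀ w w' a b c d,
        Commute (Lop (-1) β w i a b) (listMonodromy β l w' c d) := fun w w' a b c d =>
      (commute_Lop_of_forall (fun A => (commute_atSite_listMonodromy hl.1 A β w' c d).symm)
        _ _ _ _ _).symm
    simp only [listMonodromy_cons]
    rw [tensor_mul_tensor_of_commute (R := Module.End ℂ (Chain M)) (hcomm v u),
      tensor_mul_tensor_of_commute (R := Module.End ℂ (Chain M)) (hcomm u v), ← mul_assoc, braidMatrix_mul_Lop,
      mul_assoc, ih hl.2, mul_assoc]

end

section

section Exchange

variable {R : Type*} [Ring R] [Algebra ℂ R] {P Q : Matrix (Fin 2) (Fin 2) R} {u v : ℂ}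

/-- In these corner entries the `R`-matrix contributes only the scalar `u + v` on each side. -/
lemma commute_of_braid (h : braidMatrix R u v * tensor P Q = tensor Q P * braidMatrix R u v)
    (huv : u + v ≠ 0) : Commute (P 0 1) (Q 0 1) ∧ Commute (P 1 0) (Q 1 0) := by
  constructor
  · have h1 := congrFun₂ h (0, 0) (1, 1)
    simp only [Matrix.mul_apply, Fintype.sum_prod_type, braidMatrix, tensor,
      Algebra.algebraMap_eq_smul_one] at h1
    simp at h1
    exact smul_right_injective R huv h1
  · have h1 := congrFun₂ h (1, 1) (0, 0)
    simp only [Matrix.mul_apply, Fintype.sum_prod_type, braidMatrix, tensor,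
      Algebra.algebraMap_eq_smul_one] at h1
    simp at h1
    exact smul_right_injective R huv h1

/-- A single relation leaves a product in an unwanted order (`Q 0 0 * P 0 1`, resp. `P 1 0 * Q 0
0`). The relation with `u`, `v` swapped eliminates it; since `(u+v)² - 4uv = (u-v)²`, a factor `u -
v` can then be cancelled. -/
lemma exchange_of_braid (h : braidMatrix R u v * tensor P Q = tensor Q P * braidMatrix R u v)
    (h' : braidMatrix R v u * tensor Q P = tensor P Q * braidMatrix R v u) (huv : u ≠ v) :
    (u - v) • (P 0 0 * Q 0 1) = -(u + v) • (Q 0 1 * P 0 0) + (2 * v) • (P 0 1 * Q 0 0) ∧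
    (u - v) • (Q 1 0 * P 0 0) = -(u + v) • (P 0 0 * Q 1 0) + (2 * u) • (Q 0 0 * P 1 0) := by
  have h1 := congrFun₂ h (0, 0) (0, 1)
  have h2 := congrFun₂ h' (0, 0) (0, 1)
  have h3 := congrFun₂ h (1, 0) (0, 0)
  have h4 := congrFun₂ h' (1, 0) (0, 0)
  simp only [Matrix.mul_apply, Fintype.sum_prod_type, braidMatrix, tensor,
    Algebra.algebraMap_eq_smul_one] at h1 h2 h3 h4
  simp [-neg_sub] at h1 h2 h3 h4
  have hne : u - v ≠ 0 := sub_ne_zero.mpr huv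
  constructor
  · apply smul_right_injective R hne
    simp only
    linear_combination (norm := module) (u + v) • h1 + (2 * v) • h2
  · apply smul_right_injective R hne
    simp only
    linear_combination (norm := module) (-(u + v)) • h3 + (-(2 * u)) • h4

end Exchange

variable {M : ℕ}

lemma commute_listMonodromy (β : ℂ) {l : List (Fin M)} (hl : l.Nodup) {u v : ℂ} (huv : u + v ≠ 0) :
    Commute (listMonodromy β l u 0 1) (listMonodromy β l v 0 1) ∧
      Commute (listMonodromy β l u 1 0) (listMonodromy β l v 1 0) :=
  commute_of_braid (R := Module.End ℂ (Chain M)) (braidMatrix_mul_listMonodromy β u v hl) huv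

lemma exchange_listMonodromy (β : ℂ) {l : List (Fin M)} (hl : l.Nodup) {u v : ℂ} (huv : u ≠ v) :
    (u - v) • (listMonodromy β l u 0 0 * listMonodromy β l v 0 1) =
      -(u + v) • (listMonodromy β l v 0 1 * listMonodromy β l u 0 0) +
        (2 * v) • (listMonodromy β l u 0 1 * listMonodromy β l v 0 0) ∧
    (u - v) • (listMonodromy β l v 1 0 * listMonodromy β l u 0 0) =
      -(u + v) • (listMonodromy β l u 0 0 * listMonodromy β l v 1 0) +
        (2 * u) • (listMonodromy β l v 0 0 * listMonodromy β l u 1 0) :=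
  exchange_of_braid (R := Module.End ℂ (Chain M)) (braidMatrix_mul_listMonodromy β u v hl)
    (braidMatrix_mul_listMonodromy β v u hl) huv

/-! ## Bethe vectors -/

section Bethe

variable {ι V : Type*} [AddCommGroup V] [Module ℂ V]

/-- The product over a finite set of a commuting family of operators. -/
def commProd {B : ι → Module.End ℂ V} (hB : ∀ i j, Commute (B i) (B j)) (s : Finset ι) :
    Module.End ℂ V :=
  s.noncommProd B fun i _ j _ _ => hB i j

lemma commProd_empty {B : ι → Module.End ℂ V} (hB : ∀ i j, Commute (B i) (B j)) :
    commProd hB ∅ = 1 :=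
  Finset.noncommProd_empty _ _

lemma commute_commProd_right {B : ι → Module.End ℂ V} (hB : ∀ i j, Commute (B i) (B j))
    {X : Module.End ℂ V} (h : ∀ i, Commute X (B i)) (s : Finset ι) : Commute X (commProd hB s) :=
  Finset.noncommProd_induction _ _ _ (Commute X) (fun _ _ h h' => h.mul_right h')
    (Commute.one_right X) fun i _ => h i

variable [DecidableEq ι]

lemma commProd_insert {B : ι → Module.End ℂ V} (hB : ∀ i j, Commute (B i) (B j)) {s : Finset ι}
    {i : ι} (hi : i ∉ s) : commProd hB (insert i s) = B i * commProd hB s :=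
  Finset.noncommProd_insert_of_notMem _ _ _ _ hi

lemma commProd_toFinset {B : ι → Module.End ℂ V} (hB : ∀ i j, Commute (B i) (B j)) {l : List ι}
    (hl : l.Nodup) : commProd hB l.toFinset = (l.map B).prod :=
  Finset.noncommProd_toFinset _ _ _ hl

/-- The scattering factor of a pair of spectral parameters. -/
def scatter (u v : ℂ) : ℂ := (u + v) / (u - v)

variable {p : ι → ℂ} {A B : ι → Module.End ℂ V} {a : ι → ℂ} {Ω : V}

/-- The action of the diagonal operator on an off-shell Bethe vector. -/
lemma diagonal_apply_commProd (hp : Function.Injective p) (hB : ∀ i j, Commute (B i) (B j))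
    (hAB : ∀ i j, i ≠ j → (p i - p j) • (A i * B j) =
      -(p i + p j) • (B j * A i) + (2 * p j) • (B i * A j))
    (hA : ∀ i, A i Ω = a i • Ω) (s : Finset ι) {k : ι} (hk : k ∉ s) :
    A k (commProd hB s Ω) = ((∏ j ∈ s, scatter (p j) (p k)) * a k) • commProd hB s Ω +
      ∑ j ∈ s, (2 * p j / (p k - p j) * (∏ i ∈ s.erase j, scatter (p i) (p j)) * a j) •
        B k (commProd hB (s.erase j) Ω) := by
  induction s using Finset.induction_on generalizing k with
  | empty => simp [commProd_empty, hA]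
  | insert l s hl ih =>
    simp only [Finset.mem_insert, not_or] at hk
    have hkl : p k - p l ≠ 0 := sub_ne_zero.mpr fun h => hk.1 (hp h)
    have hAB' : A k * B l = scatter (p l) (p k) • (B l * A k) +
        (2 * p l / (p k - p l)) • (B k * A l) := by
      apply smul_right_injective _ hkl
      simp only
      rw [hAB k l hk.1, smul_add, smul_smul, smul_smul, scatter]
      have hlk : p l - p k ≠ 0 := by rwa [← neg_ne_zero, neg_sub]
      congr 2 <;> field_simp
      ring
    rw [commProd_insert hB hl, Module.End.mul_apply, ← Module.End.mul_apply (A k), hAB',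
      LinearMap.add_apply, LinearMap.smul_apply, LinearMap.smul_apply, Module.End.mul_apply,
      Module.End.mul_apply, ih hk.2, ih hl, Finset.sum_insert hl, Finset.prod_insert hl,
      Finset.erase_insert hl]
    -- The term without `B j` arises in two ways: `A k` passes `B l` and is later exchanged with `B
    -- j`, or it is exchanged with `B l` first.
    have hsum : ∑ j ∈ s, (2 * p j / (p k - p j) *
          (∏ i ∈ (insert l s).erase j, scatter (p i) (p j)) * a j) •
            B k (commProd hB ((insert l s).erase j) Ω) =
        scatter (p l) (p k) • ∑ j ∈ s, (2 * p j / (p k - p j) *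
          (∏ i ∈ s.erase j, scatter (p i) (p j)) * a j) • B l (B k (commProd hB (s.erase j) Ω)) +
        (2 * p l / (p k - p l)) • ∑ j ∈ s, (2 * p j / (p l - p j) *
          (∏ i ∈ s.erase j, scatter (p i) (p j)) * a j) •
            B k (B l (commProd hB (s.erase j) Ω)) := by
      rw [Finset.smul_sum, Finset.smul_sum, ← Finset.sum_add_distrib]
      refine Finset.sum_congr rfl fun j hj => ?_
      have hjl : j ≠ l := fun h => hl (h ▸ hj)
      have hjk : j ≠ k := fun h => hk.2 (h ▸ hj)
      have hl' : l ∉ s.erase j := fun h => hl (Finset.mem_of_mem_erase h)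
      rw [Finset.erase_insert_of_ne hjl.symm, Finset.prod_insert hl', commProd_insert hB hl',
        Module.End.mul_apply, ← Module.End.mul_apply (B l) (B k), ← (hB k l).eq,
        Module.End.mul_apply, smul_smul, smul_smul, ← add_smul]
      congr 1
      have h1 : p k - p j ≠ 0 := sub_ne_zero.mpr fun h => hjk (hp h).symm
      have h2 : p l - p j ≠ 0 := sub_ne_zero.mpr fun h => hjl (hp h).symm
      have h3 : p l - p k ≠ 0 := by rwa [← neg_ne_zero, neg_sub]
      -- The partial-fraction identity that merges these two contributions.
      have key : 2 * p j / (p k - p j) * scatter (p l) (p j) =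
          scatter (p l) (p k) * (2 * p j / (p k - p j)) +
            2 * p l / (p k - p l) * (2 * p j / (p l - p j)) := by
        simp only [scatter]
        rw [← neg_sub (p l) (p k)] at *
        field_simp
        ring
      linear_combination ((∏ i ∈ s.erase j, scatter (p i) (p j)) * a j) * key
    rw [hsum]
    simp only [map_add, map_sum, map_smul, smul_add]
    module

/-- Splitting a site with coupling `c` off a Bethe vector, to first order in `c`. -/
lemma commProd_apply_eq_add (hp : Function.Injective p) (hB : ∀ i j, Commute (B i) (B j))
    (hAB : ∀ i j, i ≠ j → (p i - p j) • (A i * B j) =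
      -(p i + p j) • (B j * A i) + (2 * p j) • (B i * A j))
    (hA : ∀ i, A i Ω = a i • Ω) {E : ι → Module.End ℂ V} (hE : ∀ i j, Commute (E i) (E j))
    {c : Module.End ℂ V} (hcA : ∀ i, Commute c (A i)) (hcB : ∀ i, Commute c (B i)) {r : ι → ℂ}
    (hEc : ∀ i, E i = r i • (B i + c * A i)) (s : Finset ι) :
    ∃ w, commProd hE s Ω = (∏ i ∈ s, r i) • (commProd hB s Ω +
      c (∑ j ∈ s, ((∏ i ∈ s.erase j, scatter (p i) (p j)) * a j) • commProd hB (s.erase j) Ω) +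
      c (c w)) := by
  induction s using Finset.induction_on with
  | empty => exact ⟨0, by simp [commProd_empty]⟩
  | insert k s hk ih =>
    obtain ⟨w, hw⟩ := ih
    -- The terms of order at least two in `c` when `B k + c * A k` is applied to the expansion for
    -- `s`.
    refine ⟨A k (∑ j ∈ s, ((∏ i ∈ s.erase j, scatter (p i) (p j)) * a j) •
      commProd hB (s.erase j) Ω) + B k w + c (A k w), ?_⟩
    have hBk : ∀ x, B k (c x) = c (B k x) := fun x => (LinearMap.congr_fun (hcB k).eq x).symm
    have hAk : ∀ x, A k (c x) = c (A k x) := fun x => (LinearMap.congr_fun (hcA k).eq x).symm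
    have hsum : ∑ j ∈ insert k s, ((∏ i ∈ (insert k s).erase j, scatter (p i) (p j)) * a j) •
        commProd hB ((insert k s).erase j) Ω = A k (commProd hB s Ω) +
          B k (∑ j ∈ s, ((∏ i ∈ s.erase j, scatter (p i) (p j)) * a j) •
            commProd hB (s.erase j) Ω) := by
      rw [diagonal_apply_commProd hp hB hAB hA s hk, Finset.sum_insert hk, Finset.erase_insert hk,
        add_assoc]
      congr 1
      rw [map_sum, ← Finset.sum_add_distrib]
      refine Finset.sum_congr rfl fun j hj => ?_
      have hjk : j ≠ k := fun h => hk (h ▸ hj)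
      have hk' : k ∉ s.erase j := fun h => hk (Finset.mem_of_mem_erase h)
      rw [Finset.erase_insert_of_ne hjk.symm, Finset.prod_insert hk', commProd_insert hB hk',
        Module.End.mul_apply, map_smul, ← add_smul]
      congr 1
      have h1 : p k - p j ≠ 0 := sub_ne_zero.mpr fun h => hjk (hp h).symm
      -- The fraction comes from exchanging `A k` with `B j`, the `1` from `B k` acting on the old
      -- first-order term.
      have key : scatter (p k) (p j) = 2 * p j / (p k - p j) + 1 := by
        rw [scatter]
        field_simp
        ring
      rw [key]
      ring
    rw [hsum, commProd_insert hE hk, commProd_insert hB hk, Module.End.mul_apply, hw, hEc,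
      Finset.prod_insert hk]
    simp only [LinearMap.smul_apply, LinearMap.add_apply, Module.End.mul_apply, map_add, map_smul,
      hBk, hAk]
    module

end Bethe

end

section

/-! ## Laplace expansion of the determinantal formula -/

/-- The product of the scattering factors over all ordered pairs. -/
def scatterProd {n : ℕ} (v : Fin n → ℂ) : ℂ :=
  ∏ j, ∏ k ∈ Finset.Ioi j, scatter (v j) (v k)

/-- Moving `v p` to the end flips the antisymmetric factors of the `n - p` pairs in which it came
first. The resulting sign is the one in the Laplace expansion along the last column. -/
lemma scatterProd_succAbove {n : ℕ} {v : Fin (n + 1) → ℂ} (p : Fin (n + 1)) :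
    (-1) ^ ((p : ℕ) + n) * scatterProd v =
      (∏ i, scatter (v (p.succAbove i)) (v p)) * scatterProd (v ∘ p.succAbove) := by
  have hIoi : ∀ (m : ℕ) (w : Fin m → ℂ), scatterProd w =
      ∏ j, ∏ k, if j < k then scatter (w j) (w k) else 1 := fun m w =>
    Finset.prod_congr rfl fun j _ => by rw [Finset.prod_ite, Finset.prod_const_one, mul_one]; congr 1; ext; simp
  have hanti : ∀ a b, scatter a b = -scatter b a := fun a b => by
    rw [scatter, scatter, ← neg_sub b a, div_neg, add_comm]
  have hsign : ∏ i : Fin n, (if p < p.succAbove i then (-1 : ℂ) else 1) = (-1) ^ (n - (p : ℕ)) := by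
    rw [Finset.prod_ite, Finset.prod_const_one, mul_one, Finset.prod_const]
    congr 1
    rcases Fin.eq_castSucc_or_eq_last p with ⟨q, rfl⟩ | rfl
    · simp only [Fin.lt_succAbove_iff_le_castSucc, Fin.castSucc_le_castSucc_iff, Fin.val_castSucc]
      rw [← Fin.card_Ici]
      congr 1
      ext; simp
    · simp [Fin.le_last]
  have hpow : (-1 : ℂ) ^ (n - (p : ℕ)) = (-1) ^ ((p : ℕ) + n) := by
    have : n + p = (n - p) + 2 * p := by have := p.is_le; omega
    rw [add_comm (p : ℕ), this, pow_add, pow_mul]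
    simp
  rw [hIoi, hIoi, Fin.prod_univ_succAbove _ p]
  simp only [Fin.prod_univ_succAbove _ p, lt_self_iff_false, if_false, one_mul,
    Finset.prod_mul_distrib, Fin.succAbove_lt_succAbove_iff, Function.comp_apply]
  rw [← mul_assoc, ← mul_assoc, mul_assoc (_ ^ _), ← Finset.prod_mul_distrib, ← hpow, ← hsign,
    ← Finset.prod_mul_distrib]
  congr 1
  refine Finset.prod_congr rfl fun i _ => ?_
  rcases lt_or_gt_of_ne (p.succAbove_ne i) with h | h
  · simp [h, h.not_gt]
  · simp [h, h.not_gt, hanti (v p)]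

lemma scatterProd_mul_det_succ {n : ℕ} (v : Fin (n + 1) → ℂ)
    (F : Matrix (Fin (n + 1)) (Fin (n + 1)) ℂ) :
    scatterProd v * F.det = ∑ q, (∏ i, scatter (v (q.succAbove i)) (v q)) * F q (Fin.last n) *
      (scatterProd (v ∘ q.succAbove) * (F.submatrix q.succAbove Fin.castSucc).det) := by
  rw [Matrix.det_succ_column F (Fin.last n), Finset.mul_sum]
  refine Finset.sum_congr rfl fun q _ => ?_
  rw [Fin.succAbove_last, Fin.val_last]
  linear_combination (F q (Fin.last n) * (F.submatrix q.succAbove Fin.castSucc).det) *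
    scatterProd_succAbove q

lemma image_erase_succAbove {ι : Type*} [DecidableEq ι] {n : ℕ} {e : Fin (n + 1) → ι}
    (he : Function.Injective e) (q : Fin (n + 1)) :
    (Finset.univ.image e).erase (e q) = Finset.univ.image (e ∘ q.succAbove) := by
  ext i
  simp only [Finset.mem_erase, Finset.mem_image, Finset.mem_univ, true_and, Function.comp_apply]
  constructor
  · rintro ⟨h, j, rfl⟩
    obtain ⟨k, rfl⟩ := Fin.exists_succAbove_eq (fun hjq : j = q => h (hjq ▸ rfl))
    exact ⟨k, rfl⟩
  · rintro ⟨k, rfl⟩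
    exact ⟨fun h => q.succAbove_ne k (he h), _, rfl⟩

/-- Bethe vectors are indexed by sets of labels and minors by deleted rows; the injection `e`
translates one into the other. -/
lemma sum_image_erase {ι : Type*} [DecidableEq ι] (p : ι → ℂ) (G : ι → ℂ) (H : Finset ι → ℂ)
    {n : ℕ} {e : Fin (n + 1) → ι} (he : Function.Injective e) :
    ∑ j ∈ Finset.univ.image e,
        (∏ i ∈ (Finset.univ.image e).erase j, scatter (p i) (p j)) * G j *
          H ((Finset.univ.image e).erase j) =
      ∑ q, (∏ i, scatter (p (e (q.succAbove i))) (p (e q))) * G (e q) *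
        H (Finset.univ.image (e ∘ q.succAbove)) := by
  rw [Finset.sum_image he.injOn]
  refine Finset.sum_congr rfl fun q _ => ?_
  rw [image_erase_succAbove he, Finset.prod_image
    (he.comp (Fin.succAbove_right_injective)).injOn]
  rfl

/-! ## Configurations -/

variable {M : ℕ}

/-- The configuration with particles at the given positions. -/
def configuration (M : ℕ) {n : ℕ} (x : Fin n → ℕ) (i : Fin M) : ℕ :=
  (Finset.univ.filter fun j => x j = (i : ℕ) + 1).card

lemma configuration_eq_zero {n : ℕ} {x : Fin n → ℕ} {i : Fin M} (h : ∀ j, x j ≠ i + 1) :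
    configuration M x i = 0 := by
  simp [configuration, h]

lemma configuration_eq_one {n : ℕ} {x : Fin n → ℕ} (hx : Function.Injective x) {i : Fin M}
    {j : Fin n} (h : x j = i + 1) : configuration M x i = 1 := by
  rw [configuration, Finset.card_eq_one]
  refine ⟨j, ?_⟩
  ext k
  simp [← h, hx.eq_iff]

lemma update_configuration {n : ℕ} {x : Fin (n + 1) → ℕ} (hx : Function.Injective x) {i : Fin M}
    (h : x (Fin.last n) = i + 1) :
    Function.update (configuration M x) i 0 = configuration M (x ∘ Fin.castSucc) := by
  funext k
  by_cases hk : k = i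
  · subst hk
    rw [Function.update_self, configuration_eq_zero]
    intro j hj
    exact (Fin.castSucc_lt_last j).ne (hx (hj.trans h.symm))
  · rw [Function.update_of_ne hk, configuration, configuration, Finset.card_filter,
      Finset.card_filter, Fin.sum_univ_castSucc, if_neg, add_zero]
    · rfl
    · rw [h]
      intro h'
      exact hk (Fin.ext (by omega))

lemma configuration_empty (x : Fin 0 → ℕ) : configuration M x = 0 := by
  funext i
  simp [configuration]

/-! ## Splitting off a site -/

/-- Annihilation kills an empty site, so each `L`-operator acts triangularly and contributes `1 -
βv` on the diagonal. -/
lemma listMonodromy_vacuum (β v : ℂ) (l : List (Fin M)) :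
    listMonodromy β l v 0 0 (ket 0) = (1 - β * v) ^ l.length • ket 0 ∧
      listMonodromy β l v 1 0 (ket 0) = 0 := by
  induction l with
  | nil => simp [listMonodromy]
  | cons i l ih =>
    simp only [listMonodromy_cons, Matrix.mul_apply, Fin.sum_univ_two, LinearMap.add_apply,
      Module.End.mul_apply, ih, map_smul, map_zero, add_zero]
    have h0 : atSite i annihilation (ket 0) = 0 := by simp [ket, annihilation_site_single]
    have hq : atSite i (tPowNumber (-1)) (ket 0) = ket 0 := by
      simp [ket, tPowNumber_site_single]
    constructor
    · simp only [Lop, Matrix.of_apply, Matrix.cons_val', Matrix.cons_val_zero,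
        LinearMap.sub_apply, LinearMap.smul_apply, Module.End.one_apply, hq, List.length_cons]
      module
    · simp [Lop, h0]

lemma listMonodromy_dual_vacuum (β v : ℂ) (l : List (Fin M)) (y : Chain M) :
    listMonodromy β l v 0 0 y 0 = (1 - β * v) ^ l.length * y 0 := by
  induction l with
  | nil => simp [listMonodromy]
  | cons i l ih =>
    have hq : ∀ w : Chain M, atSite i (tPowNumber (-1)) w 0 = w 0 := by
      intro w
      induction w using Finsupp.induction_linear with
      | zero => simp
      | add f g hf hg => simp [hf, hg]
      | single n a =>
        rw [tPowNumber_site_single, Finsupp.single_apply, Finsupp.single_apply]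
        split_ifs with h
        · simp [h]
        · rfl
    have hc := fun w : Chain M => creation_site_apply_of_eq_zero (i := i) (m := 0) rfl w
    simp only [listMonodromy_cons, Matrix.mul_apply, Fin.sum_univ_two, LinearMap.add_apply,
      Module.End.mul_apply, Finsupp.add_apply]
    simp only [Lop, Matrix.of_apply, Matrix.cons_val', Matrix.cons_val_zero, Matrix.cons_val_one,
      LinearMap.sub_apply, LinearMap.smul_apply, Module.End.one_apply, Finsupp.sub_apply,
      Finsupp.smul_apply, hq, hc, ih, List.length_cons, smul_eq_mul]
    ring

end

section

/-! ### Transposed operators and vanishing of amplitudes at untouched sites -/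

variable {M : ℕ} {ι : Type*} {p : ι → ℂ}

lemma commute_creationOp (hpp : ∀ i j, p i + p j ≠ 0) (β : ℂ) {l : List (Fin M)} (hl : l.Nodup)
    (i j : ι) : Commute (listMonodromy β l (p i) 0 1) (listMonodromy β l (p j) 0 1) :=
  (commute_listMonodromy β hl (hpp i j)).1

/-- The transpose of an operator. -/
abbrev transposeOp (X : Module.End ℂ (Chain M)) : Module.End ℂ (Module.Dual ℂ (Chain M)) :=
  LinearMap.dualMap X

lemma transposeOp_mul (X Y : Module.End ℂ (Chain M)) :
    transposeOp (X * Y) = transposeOp Y * transposeOp X := rfl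

lemma transposeOp_add (X Y : Module.End ℂ (Chain M)) :
    transposeOp (X + Y) = transposeOp X + transposeOp Y :=
  LinearMap.ext fun f => LinearMap.ext fun _ => map_add f _ _

lemma transposeOp_smul (a : ℂ) (X : Module.End ℂ (Chain M)) :
    transposeOp (a • X) = a • transposeOp X :=
  LinearMap.ext fun f => LinearMap.ext fun _ => map_smul f _ _

lemma commute_transposeOp {X Y : Module.End ℂ (Chain M)} (h : Commute X Y) :
    Commute (transposeOp X) (transposeOp Y) := by
  rw [Commute, SemiconjBy, ← transposeOp_mul, ← transposeOp_mul, h.eq]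

lemma commute_dualOp (hpp : ∀ i j, p i + p j ≠ 0) (β : ℂ) {l : List (Fin M)} (hl : l.Nodup)
    (i j : ι) : Commute (transposeOp (listMonodromy β l (p i) 1 0))
      (transposeOp (listMonodromy β l (p j) 1 0)) :=
  commute_transposeOp (commute_listMonodromy β hl (hpp i j)).2

/-- The dual vacuum. -/
def dualVacuum (M : ℕ) : Module.Dual ℂ (Chain M) := Finsupp.lapply 0

/-- Annihilation at `i` commutes with every factor and kills the vacuum, hence kills the Bethe
vector; the coefficient at `m` is a coefficient of that image. -/
lemma commProd_apply_of_notMem (hpp : ∀ i j, p i + p j ≠ 0) (β : ℂ) {l : List (Fin M)}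
    (hl : l.Nodup) {i : Fin M} (hi : i ∉ l) (s : Finset ι) {m : Fin M → ℕ} (hm : m i = 1) :
    commProd (commute_creationOp hpp β hl) s (ket 0) m = 0 := by
  have h := commute_commProd_right (commute_creationOp hpp β hl)
    (fun j => commute_atSite_listMonodromy hi annihilation β (p j) 0 1) s
  rw [← annihilation_site_apply hm, ← Module.End.mul_apply, h.eq, Module.End.mul_apply]
  simp [ket, annihilation_site_single]

lemma ket_eq_creation {i : Fin M} {m : Fin M → ℕ} (hm : m i = 1) :
    ket m = (2 : ℂ)⁻¹ • atSite i (creation (-1)) (ket (Function.update m i 0)) := by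
  rw [ket, ket, creation_site_single, Finsupp.smul_single]
  simp only [Function.update_self, Function.update_idem, zero_add, ← hm, Function.update_eq_self]
  norm_num [hm]

lemma dual_commProd_apply_of_notMem (hpp : ∀ i j, p i + p j ≠ 0) (β : ℂ) {l : List (Fin M)}
    (hl : l.Nodup) {i : Fin M} (hi : i ∉ l) (s : Finset ι) {m : Fin M → ℕ} (hm : m i = 1) :
    commProd (commute_dualOp hpp β hl) s (dualVacuum M) (ket m) = 0 := by
  have h := commute_commProd_right (commute_dualOp hpp β hl) (fun j => commute_transposeOp
    (commute_atSite_listMonodromy hi (creation (-1)) β (p j) 1 0)) s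
  have h0 : transposeOp (atSite i (creation (-1))) (dualVacuum M) = 0 :=
    LinearMap.ext fun y => creation_site_apply_of_eq_zero (m := 0) rfl y
  rw [ket_eq_creation hm, map_smul, ← LinearMap.dualMap_apply, ← Module.End.mul_apply, h.eq,
    Module.End.mul_apply, h0, map_zero, LinearMap.zero_apply, smul_zero]

/-! ### Recursion of Bethe vectors under removal of a site -/

variable [DecidableEq ι]

lemma commProd_concat_eq (hp : Function.Injective p) (hpp : ∀ i j, p i + p j ≠ 0) (β : ℂ)
    {l : List (Fin M)} {i : Fin M} (hl : l.Nodup) (hl' : (l ++ [i]).Nodup) (hi : i ∉ l)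
    (s : Finset ι) :
    commProd (commute_creationOp hpp β hl') s (ket 0) = (∏ j ∈ s, p j) •
      (commProd (commute_creationOp hpp β hl) s (ket 0) + atSite i (creation (-1))
        (∑ j ∈ s, ((∏ k ∈ s.erase j, scatter (p k) (p j)) * (1 - β * p j) ^ l.length) •
          commProd (commute_creationOp hpp β hl) (s.erase j) (ket 0))) := by
  have hc := commute_atSite_listMonodromy hi (creation (-1)) β
  obtain ⟨w, hw⟩ := commProd_apply_eq_add (Ω := ket 0) (A := fun j => listMonodromy β l (p j) 0 0)
    (c := atSite i (creation (-1))) (a := fun j => (1 - β * p j) ^ l.length) (r := p) hp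
    (commute_creationOp hpp β hl)
    (fun j k hjk => (exchange_listMonodromy β hl (hp.ne hjk)).1)
    (fun j => (listMonodromy_vacuum β (p j) l).1) (commute_creationOp hpp β hl')
    (fun j => hc (p j) 0 0) (fun j => hc (p j) 0 1)
    (fun j => by
      rw [listMonodromy_concat, Matrix.mul_apply, Fin.sum_univ_two]
      change listMonodromy β l (p j) 0 0 * (p j • atSite i (creation (-1))) +
        listMonodromy β l (p j) 0 1 * (p j • 1) = _
      rw [mul_smul_comm, mul_smul_comm, mul_one, (hc (p j) 0 0).eq, smul_add, add_comm]) s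
  have hcc : atSite i (creation (-1)) (atSite i (creation (-1)) w) = 0 := by
    rw [← Module.End.mul_apply, creation_mul_creation, LinearMap.zero_apply]
  rw [hw, hcc, add_zero]

lemma commProd_concat_apply_of_eq_zero (hp : Function.Injective p) (hpp : ∀ i j, p i + p j ≠ 0)
    (β : ℂ) {l : List (Fin M)} {i : Fin M} (hl : l.Nodup) (hl' : (l ++ [i]).Nodup) (hi : i ∉ l)
    (s : Finset ι) {m : Fin M → ℕ} (hm : m i = 0) :
    commProd (commute_creationOp hpp β hl') s (ket 0) m =
      (∏ j ∈ s, p j) * commProd (commute_creationOp hpp β hl) s (ket 0) m := by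
  rw [commProd_concat_eq hp hpp β hl hl' hi, Finsupp.smul_apply, Finsupp.add_apply,
    creation_site_apply_of_eq_zero hm, add_zero, smul_eq_mul]

lemma commProd_concat_apply_of_eq_one (hp : Function.Injective p) (hpp : ∀ i j, p i + p j ≠ 0)
    (β : ℂ) {l : List (Fin M)} {i : Fin M} (hl : l.Nodup) (hl' : (l ++ [i]).Nodup) (hi : i ∉ l)
    (s : Finset ι) {m : Fin M → ℕ} (hm : m i = 1) :
    commProd (commute_creationOp hpp β hl') s (ket 0) m =
      (∏ j ∈ s, p j) * ∑ j ∈ s, (∏ k ∈ s.erase j, scatter (p k) (p j)) *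
        (2 * (1 - β * p j) ^ l.length) *
          commProd (commute_creationOp hpp β hl) (s.erase j) (ket 0) (Function.update m i 0) := by
  rw [commProd_concat_eq hp hpp β hl hl' hi, Finsupp.smul_apply, Finsupp.add_apply,
    creation_site_apply_of_eq_one hm, commProd_apply_of_notMem hpp β hl hi s hm, zero_add,
    smul_eq_mul, Finsupp.finsetSum_apply]
  congr 1
  rw [Finset.mul_sum]
  refine Finset.sum_congr rfl fun j _ => ?_
  rw [Finsupp.smul_apply, smul_eq_mul]
  ring

/-- Here the coupling is the transposed annihilation operator. It does not square to zero, so a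
second-order remainder `w` stays; it vanishes later on kets with at most one particle at `i`. The
diagonal operator is rescaled by `(p j)⁻¹` to fit the general splitting. -/
lemma commProd_cons_eq (hp : Function.Injective p) (hp0 : ∀ i, p i ≠ 0)
    (hpp : ∀ i j, p i + p j ≠ 0) (β : ℂ)
    {l : List (Fin M)} {i : Fin M} (hl : l.Nodup) (hl' : (i :: l).Nodup) (hi : i ∉ l)
    (s : Finset ι) :
    ∃ w, commProd (commute_dualOp hpp β hl') s (dualVacuum M) = (∏ j ∈ s, p j) •
      (commProd (commute_dualOp hpp β hl) s (dualVacuum M) + transposeOp (atSite i annihilation)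
        (∑ j ∈ s, ((∏ k ∈ s.erase j, scatter (p k) (p j)) *
            ((p j)⁻¹ * (1 - β * p j) ^ l.length)) •
          commProd (commute_dualOp hpp β hl) (s.erase j) (dualVacuum M)) +
        transposeOp (atSite i annihilation) (transposeOp (atSite i annihilation) w)) := by
  have hc := commute_atSite_listMonodromy hi annihilation β
  refine commProd_apply_eq_add (Ω := dualVacuum M)
    (A := fun j => (p j)⁻¹ • transposeOp (listMonodromy β l (p j) 0 0))
    (c := transposeOp (atSite i annihilation))
    (a := fun j => (p j)⁻¹ * (1 - β * p j) ^ l.length) (r := p) hp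
    (commute_dualOp hpp β hl) (fun j k hjk => ?_) (fun j => ?_) (commute_dualOp hpp β hl')
    (fun j => (commute_transposeOp (hc (p j) 0 0)).smul_right _)
    (fun j => commute_transposeOp (hc (p j) 1 0)) (fun j => ?_) s
  · have h := congrArg transposeOp (exchange_listMonodromy β hl (hp.ne hjk)).2
    rw [transposeOp_add] at h
    simp only [transposeOp_smul, transposeOp_mul] at h
    have hj := mul_inv_cancel₀ (hp0 j)
    have hk := mul_inv_cancel₀ (hp0 k)
    simp only [smul_mul_assoc, mul_smul_comm, smul_smul]
    have h' := congrArg ((p j)⁻¹ • ·) h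
    simp only [smul_add, smul_smul] at h'
    rw [mul_comm _ (p j)⁻¹, h']
    congr 2
    · ring
    -- The rescaling turns the exchange coefficient `2 * p j` into the required `2 * p k`: `2 (p
    -- j)⁻¹ p j = 2 = 2 p k (p k)⁻¹`.
    · linear_combination 2 * hj - 2 * hk
  · refine LinearMap.ext fun y => ?_
    change (p j)⁻¹ * (listMonodromy β l (p j) 0 0 y 0) = _ * y 0
    rw [listMonodromy_dual_vacuum, mul_assoc]
  · have h : listMonodromy β (i :: l) (p j) 1 0 = listMonodromy β l (p j) 0 0 *
        atSite i annihilation + p j • listMonodromy β l (p j) 1 0 := by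
      rw [listMonodromy_cons, Matrix.mul_apply, Fin.sum_univ_two, ← (hc (p j) 0 0).eq]
      congr 1
    rw [h, transposeOp_add, transposeOp_smul, transposeOp_mul, mul_smul_comm, smul_add, smul_smul,
      mul_inv_cancel₀ (hp0 j), one_smul, add_comm]

lemma dual_commProd_cons_apply_of_eq_zero (hp : Function.Injective p) (hp0 : ∀ i, p i ≠ 0)
    (hpp : ∀ i j, p i + p j ≠ 0)
    (β : ℂ) {l : List (Fin M)} {i : Fin M} (hl : l.Nodup) (hl' : (i :: l).Nodup) (hi : i ∉ l)
    (s : Finset ι) {m : Fin M → ℕ} (hm : m i = 0) :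
    commProd (commute_dualOp hpp β hl') s (dualVacuum M) (ket m) =
      (∏ j ∈ s, p j) * commProd (commute_dualOp hpp β hl) s (dualVacuum M) (ket m) := by
  obtain ⟨w, hw⟩ := commProd_cons_eq hp hp0 hpp β hl hl' hi s
  have h0 : atSite i annihilation (ket m) = 0 := by simp [ket, annihilation_site_single, hm]
  rw [hw, LinearMap.smul_apply, LinearMap.add_apply, LinearMap.add_apply, LinearMap.dualMap_apply,
    LinearMap.dualMap_apply, h0, map_zero, map_zero, add_zero, add_zero, smul_eq_mul]

lemma dual_commProd_cons_apply_of_eq_one (hp : Function.Injective p) (hp0 : ∀ i, p i ≠ 0)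
    (hpp : ∀ i j, p i + p j ≠ 0)
    (β : ℂ) {l : List (Fin M)} {i : Fin M} (hl : l.Nodup) (hl' : (i :: l).Nodup) (hi : i ∉ l)
    (s : Finset ι) {m : Fin M → ℕ} (hm : m i = 1) :
    commProd (commute_dualOp hpp β hl') s (dualVacuum M) (ket m) =
      (∏ j ∈ s, p j) * ∑ j ∈ s, (∏ k ∈ s.erase j, scatter (p k) (p j)) *
        ((p j)⁻¹ * (1 - β * p j) ^ l.length) *
          commProd (commute_dualOp hpp β hl) (s.erase j) (dualVacuum M)
            (ket (Function.update m i 0)) := by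
  obtain ⟨w, hw⟩ := commProd_cons_eq hp hp0 hpp β hl hl' hi s
  have h0 : atSite i annihilation (ket m) = ket (Function.update m i 0) := by
    simp [ket, annihilation_site_single, hm]
  have h1 : atSite i annihilation (ket (Function.update m i 0)) = 0 := by
    simp [ket, annihilation_site_single]
  rw [hw, LinearMap.smul_apply, LinearMap.add_apply, LinearMap.add_apply, LinearMap.dualMap_apply,
    LinearMap.dualMap_apply, LinearMap.dualMap_apply, h0, h1, map_zero, add_zero, smul_eq_mul,
    dual_commProd_apply_of_notMem hpp β hl hi s hm, zero_add, LinearMap.sum_apply]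
  rfl

/-! ## Determinantal formulas -/

/-- The sites from `k` on, in the order in which they occur in the monodromy matrix. -/
def sitesFrom (M k : ℕ) : List (Fin M) := ((List.finRange M).drop k).reverse

/-- The sites before `k`, in the order in which they occur in the monodromy matrix. -/
def sitesBelow (M k : ℕ) : List (Fin M) := ((List.finRange M).take k).reverse

lemma sitesFrom_nodup (M k : ℕ) : (sitesFrom M k).Nodup :=
  List.nodup_reverse.mpr ((List.nodup_finRange M).sublist (List.drop_sublist _ _))

lemma sitesBelow_nodup (M k : ℕ) : (sitesBelow M k).Nodup :=
  List.nodup_reverse.mpr ((List.nodup_finRange M).sublist (List.take_sublist _ _))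

lemma sitesFrom_eq {k : ℕ} (hk : k < M) : sitesFrom M k = sitesFrom M (k + 1) ++ [⟨k, hk⟩] := by
  rw [sitesFrom, List.drop_eq_getElem_cons (by simpa using hk), List.reverse_cons]
  simp [sitesFrom]

lemma sitesBelow_succ {k : ℕ} (hk : k < M) :
    sitesBelow M (k + 1) = ⟨k, hk⟩ :: sitesBelow M k := by
  rw [sitesBelow, List.take_succ_eq_append_getElem (by simpa using hk), List.reverse_append]
  simp [sitesBelow]

/-- Induction removes the lowest site. If it is occupied, its particle is the last in the list and
the recursion is the expansion along the last column; if empty, it only yields `∏ p`. The prefactor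
with exponent `k` accounts for the sites already removed. -/
lemma commProd_sitesFrom (hp : Function.Injective p) (hpp : ∀ i j, p i + p j ≠ 0) (β : ℂ) {k : ℕ}
    (hk : k ≤ M) {n : ℕ} {e : Fin n → ι} (he : Function.Injective e) {x : Fin n → ℕ}
    (hx : StrictAnti x) (hxk : ∀ j, k < x j) (hxM : ∀ j, x j ≤ M) :
    (∏ j, p (e j)) ^ k * commProd (commute_creationOp hpp β (sitesFrom_nodup M k))
        (Finset.univ.image e) (ket 0) (configuration M x) =
      scatterProd (p ∘ e) *
        (Matrix.of fun i j => 2 * (p (e i) ^ x j * (1 - β * p (e i)) ^ (M - x j))).det := by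
  induction hd : M - k generalizing k n with
  | zero =>
    obtain rfl : k = M := by omega
    obtain rfl : n = 0 := by
      by_contra hn
      have := hxk ⟨0, Nat.pos_of_ne_zero hn⟩
      have := hxM ⟨0, Nat.pos_of_ne_zero hn⟩
      omega
    simp [Finset.univ_eq_empty, commProd_empty, configuration_empty, ket, scatterProd]
  | succ d ih =>
    have hkM : k < M := by omega
    have hnodup := sitesFrom_nodup M k
    have hi : (⟨k, hkM⟩ : Fin M) ∉ sitesFrom M (k + 1) := by
      rw [sitesFrom_eq hkM] at hnodup
      exact fun h => (List.nodup_append.mp hnodup).2.2 _ h _ (List.mem_singleton_self _) rfl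
    have hprod : ∏ j ∈ Finset.univ.image e, p j = ∏ j, p (e j) := Finset.prod_image he.injOn
    have hlen : (sitesFrom M (k + 1)).length = M - (k + 1) := by simp [sitesFrom]
    have hS := sitesFrom_nodup M (k + 1)
    by_cases hlast : ∃ j, x j = k + 1
    · obtain _ | n := n
      · exact hlast.choose.elim0
      have hxl : x (Fin.last n) = k + 1 := by
        obtain ⟨j, hj⟩ := hlast
        exact le_antisymm (hj ▸ hx.antitone (Fin.le_last j)) (hxk _)
      have hone : configuration M x ⟨k, hkM⟩ = 1 := configuration_eq_one hx.injective hxl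
      have key := commProd_concat_apply_of_eq_one hp hpp β hS (sitesFrom_eq hkM ▸ hnodup) hi
        (Finset.univ.image e) hone
      simp only [← sitesFrom_eq hkM] at key
      rw [key, hprod, update_configuration hx.injective hxl, hlen,
        sum_image_erase p (fun j => 2 * (1 - β * p j) ^ (M - (k + 1)))
          (fun s => commProd (commute_creationOp hpp β hS) s (ket 0)
            (configuration M (x ∘ Fin.castSucc))) he, scatterProd_mul_det_succ,
        ← mul_assoc, ← pow_succ, Finset.mul_sum]
      refine Finset.sum_congr rfl fun q _ => ?_
      have hq := ih (k := k + 1) (by omega) (e := e ∘ q.succAbove) (x := x ∘ Fin.castSucc)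
        (he.comp Fin.succAbove_right_injective)
        (hx.comp_strictMono Fin.strictMono_castSucc)
        (fun j => by
          have := hx (Fin.castSucc_lt_last j)
          simp only [Function.comp_apply]
          omega) (fun j => hxM _) (by omega)
      change _ = _ * (scatterProd (p ∘ (e ∘ q.succAbove)) * Matrix.det (Matrix.of fun i j =>
        2 * (p ((e ∘ q.succAbove) i) ^ (x ∘ Fin.castSucc) j *
          (1 - β * p ((e ∘ q.succAbove) i)) ^ (M - (x ∘ Fin.castSucc) j))))
      rw [← hq, Fin.prod_univ_succAbove _ q, Matrix.of_apply, hxl, mul_pow]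
      simp only [Function.comp_apply]
      ring
    · push Not at hlast
      have hzero : configuration M x ⟨k, hkM⟩ = 0 := configuration_eq_zero hlast
      have key := commProd_concat_apply_of_eq_zero hp hpp β hS (sitesFrom_eq hkM ▸ hnodup) hi
        (Finset.univ.image e) hzero
      simp only [← sitesFrom_eq hkM] at key
      rw [key, hprod, ← mul_assoc, ← pow_succ]
      exact ih (by omega) he hx (fun j => lt_of_le_of_ne (hxk j) (hlast j).symm) hxM (by omega)

/-- The mirror image: the highest site is removed, so positions are listed increasingly to keep its
particle in the last column. -/
lemma dual_commProd_sitesBelow (hp : Function.Injective p) (hp0 : ∀ i, p i ≠ 0)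
    (hpp : ∀ i j, p i + p j ≠ 0) (β : ℂ) {k : ℕ}
    (hk : k ≤ M) {n : ℕ} {e : Fin n → ι} (he : Function.Injective e) {x : Fin n → ℕ}
    (hx : StrictMono x) (hx1 : ∀ j, 1 ≤ x j) (hxk : ∀ j, x j ≤ k) :
    (∏ j, p (e j)) ^ (M - k) * commProd (commute_dualOp hpp β (sitesBelow_nodup M k))
        (Finset.univ.image e) (dualVacuum M) (ket (configuration M x)) =
      scatterProd (p ∘ e) *
        (Matrix.of fun i j => p (e i) ^ (M - x j) * (1 - β * p (e i)) ^ (x j - 1)).det := by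
  induction k generalizing n with
  | zero =>
    obtain rfl : n = 0 := by
      by_contra hn
      have := hxk ⟨0, Nat.pos_of_ne_zero hn⟩
      have := hx1 ⟨0, Nat.pos_of_ne_zero hn⟩
      omega
    simp [Finset.univ_eq_empty, commProd_empty, configuration_empty, ket, scatterProd, dualVacuum]
  | succ k ih =>
    have hkM : k < M := by omega
    have hnodup := sitesBelow_nodup M (k + 1)
    have hi : (⟨k, hkM⟩ : Fin M) ∉ sitesBelow M k := by
      rw [sitesBelow_succ hkM] at hnodup
      exact (List.nodup_cons.mp hnodup).1
    have hprod : ∏ j ∈ Finset.univ.image e, p j = ∏ j, p (e j) := Finset.prod_image he.injOn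
    have hlen : (sitesBelow M k).length = k := by simp [sitesBelow, hkM.le]
    have hS := sitesBelow_nodup M k
    have hMk : M - k = M - (k + 1) + 1 := by omega
    by_cases hlast : ∃ j, x j = k + 1
    · obtain _ | n := n
      · exact hlast.choose.elim0
      have hxl : x (Fin.last n) = k + 1 := by
        obtain ⟨j, hj⟩ := hlast
        exact le_antisymm (hxk _) (hj ▸ hx.monotone (Fin.le_last j))
      have hone : configuration M x ⟨k, hkM⟩ = 1 := configuration_eq_one hx.injective hxl
      have key := dual_commProd_cons_apply_of_eq_one hp hp0 hpp β hS (sitesBelow_succ hkM ▸ hnodup)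
        hi (Finset.univ.image e) hone
      simp only [← sitesBelow_succ hkM] at key
      rw [key, hprod, update_configuration hx.injective hxl, hlen,
        sum_image_erase p (fun j => (p j)⁻¹ * (1 - β * p j) ^ k)
          (fun s => commProd (commute_dualOp hpp β hS) s (dualVacuum M)
            (ket (configuration M (x ∘ Fin.castSucc)))) he, scatterProd_mul_det_succ,
        ← mul_assoc, ← pow_succ, Finset.mul_sum]
      refine Finset.sum_congr rfl fun q _ => ?_
      have hq := ih (by omega) (e := e ∘ q.succAbove) (x := x ∘ Fin.castSucc)
        (he.comp Fin.succAbove_right_injective)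
        (hx.comp Fin.strictMono_castSucc) (fun j => hx1 _)
        (fun j => by
          have := hx (Fin.castSucc_lt_last j)
          simp only [Function.comp_apply]
          omega)
      change _ = _ * (scatterProd (p ∘ (e ∘ q.succAbove)) * Matrix.det (Matrix.of fun i j =>
        p ((e ∘ q.succAbove) i) ^ (M - (x ∘ Fin.castSucc) j) *
          (1 - β * p ((e ∘ q.succAbove) i)) ^ ((x ∘ Fin.castSucc) j - 1)))
      rw [← hq, Fin.prod_univ_succAbove _ q, Matrix.of_apply, hxl, mul_pow, hMk,
        Nat.add_sub_cancel]
      simp only [Function.comp_apply]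
      have hpq := mul_inv_cancel₀ (hp0 (e q))
      rw [pow_succ (p (e q))]
      linear_combination (p (e q) ^ (M - (k + 1)) * (∏ i, p (e (q.succAbove i))) ^ (M - (k + 1) + 1) *
        (∏ i, scatter (p (e (q.succAbove i))) (p (e q))) * (1 - β * p (e q)) ^ k *
        commProd (commute_dualOp hpp β hS) (Finset.univ.image (e ∘ q.succAbove)) (dualVacuum M)
            (ket (configuration M (x ∘ Fin.castSucc)))) * hpq
    · push Not at hlast
      have hzero : configuration M x ⟨k, hkM⟩ = 0 := configuration_eq_zero hlast
      have key := dual_commProd_cons_apply_of_eq_zero hp hp0 hpp β hS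
        (sitesBelow_succ hkM ▸ hnodup) hi (Finset.univ.image e) hzero
      simp only [← sitesBelow_succ hkM] at key
      rw [key, hprod, ← mul_assoc, ← pow_succ, ← hMk]
      exact ih (by omega) he hx hx1 (fun j => by have := hxk j; have := hlast j; omega)

end

section

variable {M N : ℕ}

/-! ## Wavefunctions at generic spectral parameters -/

lemma transposeOp_list_prod (l : List (Module.End ℂ (Chain M))) :
    transposeOp l.prod = (l.map transposeOp).reverse.prod := by
  induction l with
  | nil => rfl
  | cons X l ih => simp [transposeOp_mul, ih]

lemma configuration_comp_rev (x : Fin N → ℕ) :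
    configuration M (x ∘ Fin.rev) = configuration M x := by
  funext i
  rw [configuration, configuration, Finset.card_filter, Finset.card_filter]
  exact Fintype.sum_equiv Fin.revPerm _ _ fun j => rfl

lemma wavefunction_eq_det (β : ℂ) {v : Fin N → ℂ} (hv : Function.Injective v)
    (hvv : ∀ i j, v i + v j ≠ 0) {x : Fin N → ℕ} (hx : StrictAnti x) (hx1 : ∀ j, 1 ≤ x j)
    (hxM : ∀ j, x j ≤ M) :
    wavefunction (-1) β v (configuration M x) = scatterProd v *
      (Matrix.of fun i j => 2 * (v i ^ x j * (1 - β * v i) ^ (M - x j))).det := by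
  have h := commProd_sitesFrom hv hvv β (Nat.zero_le M) (e := id) Function.injective_id hx hx1 hxM
  rw [pow_zero, one_mul, Finset.image_id, ← List.toFinset_finRange,
    commProd_toFinset _ (List.nodup_finRange N), ← List.ofFn_eq_map] at h
  simp only [wavefunction, matrixElement, Bop, monodromy_eq_listMonodromy]
  exact h

/-- Transposition reverses the product, which is harmless because the factors commute; the positions
are reversed to become increasing. -/
lemma dualWavefunction_eq_det (β : ℂ) {v : Fin N → ℂ} (hv : Function.Injective v)
    (hv0 : ∀ i, v i ≠ 0) (hvv : ∀ i j, v i + v j ≠ 0) {x : Fin N → ℕ} (hx : StrictAnti x)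
    (hx1 : ∀ j, 1 ≤ x j) (hxM : ∀ j, x j ≤ M) :
    dualWavefunction (-1) β v (configuration M x) = scatterProd v *
      (Matrix.of fun i j => v i ^ (M - x (Fin.rev j)) *
        (1 - β * v i) ^ (x (Fin.rev j) - 1)).det := by
  have h := dual_commProd_sitesBelow hv hv0 hvv β le_rfl (e := id) Function.injective_id
    (x := x ∘ Fin.rev) (hx.comp Fin.rev_strictAnti) (fun j => hx1 _) (fun j => hxM _)
  rw [Nat.sub_self, pow_zero, one_mul, Finset.image_id, ← List.toFinset_finRange,
    ← List.toFinset_reverse, commProd_toFinset _ (List.nodup_reverse.mpr (List.nodup_finRange N)),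
    configuration_comp_rev] at h
  have hm : ∀ w, Cop (-1) β M w = listMonodromy β (sitesBelow M M) w 1 0 := fun w => by
    rw [Cop, monodromy_eq_listMonodromy, sitesBelow, List.take_of_length_le (by simp)]
  have hT := LinearMap.congr_fun (LinearMap.congr_fun (transposeOp_list_prod
    (List.ofFn fun j => Cop (-1) β M (v j))) (dualVacuum M)) (ket (configuration M x))
  refine Eq.trans (b := transposeOp (List.ofFn fun j => Cop (-1) β M (v j)).prod (dualVacuum M)
    (ket (configuration M x))) rfl (hT.trans ?_)
  rw [List.ofFn_eq_map, List.map_map, ← List.map_reverse]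
  simp only [hm]
  exact h

/-! ## Continuity in the spectral parameters -/

/-- A family of operators all of whose matrix coefficients are continuous. -/
def IsContinuousFamily {P : Type*} [TopologicalSpace P] (X : P → Module.End ℂ (Chain M)) : Prop :=
  ∀ (φ : Module.Dual ℂ (Chain M)) (w : Chain M), Continuous fun u => φ (X u w)

section Continuity

variable {P : Type*} [TopologicalSpace P] {f : P → ℂ}

lemma IsContinuousFamily.Lop_mul (hf : Continuous f) (t β : ℂ) (i : Fin M) (a b : Fin 2)
    {X : P → Module.End ℂ (Chain M)} (hX : IsContinuousFamily X) :
    IsContinuousFamily fun u => Lop t β (f u) i a b * X u := by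
  intro φ w
  fin_cases a <;> fin_cases b
  · change Continuous fun u => φ ((1 - (β * f u) • atSite i (tPowNumber t)) (X u w))
    simp only [LinearMap.sub_apply, LinearMap.smul_apply, Module.End.one_apply, map_sub, map_smul]
    -- A fixed operator on the left is absorbed into the functional, which is why continuity is
    -- required for all `φ`.
    exact (hX φ w).sub ((continuous_const.mul hf).smul (hX (φ ∘ₗ atSite i (tPowNumber t)) w))
  · change Continuous fun u => φ ((f u • atSite i (creation t)) (X u w))
    simp only [LinearMap.smul_apply, map_smul]
    exact hf.smul (hX (φ ∘ₗ atSite i (creation t)) w)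
  · exact hX (φ ∘ₗ atSite i annihilation) w
  · change Continuous fun u => φ ((f u • (1 : Module.End ℂ (Chain M))) (X u w))
    simp only [LinearMap.smul_apply, Module.End.one_apply, map_smul]
    exact hf.smul (hX φ w)

lemma IsContinuousFamily.listMonodromy_mul (hf : Continuous f) (β : ℂ) (l : List (Fin M))
    (a b : Fin 2) {X : P → Module.End ℂ (Chain M)} (hX : IsContinuousFamily X) :
    IsContinuousFamily fun u => listMonodromy β l (f u) a b * X u := by
  induction l generalizing a with
  | nil =>
    intro φ w
    simp only [listMonodromy, List.map_nil, List.prod_nil, Matrix.one_apply]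
    split_ifs
    · simpa using hX φ w
    · simpa using continuous_const
  | cons i l ih =>
    intro φ w
    simp only [listMonodromy_cons, Matrix.mul_apply, Fin.sum_univ_two, add_mul, mul_assoc,
      LinearMap.add_apply, map_add]
    exact ((ih 0).Lop_mul hf (-1) β i a 0 φ w).add ((ih 1).Lop_mul hf (-1) β i a 1 φ w)

lemma IsContinuousFamily.list_prod {g : P → Fin N → ℂ} (hg : ∀ j, Continuous fun u => g u j)
    (β : ℂ) (a b : Fin 2) (l : List (Fin N)) :
    IsContinuousFamily fun u => (l.map fun j => monodromy (-1) β (g u j) M a b).prod := by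
  induction l with
  | nil =>
    intro φ w
    simpa using continuous_const
  | cons j l ih =>
    simp only [List.map_cons, List.prod_cons, monodromy_eq_listMonodromy] at ih ⊢
    exact ih.listMonodromy_mul (hg j) β _ a b

lemma continuous_wavefunction {g : P → Fin N → ℂ} (hg : ∀ j, Continuous fun u => g u j) (β : ℂ)
    (m : Fin M → ℕ) : Continuous fun u => wavefunction (-1) β (g u) m := by
  simp only [wavefunction, List.ofFn_eq_map]
  exact IsContinuousFamily.list_prod hg β 0 1 _ (Finsupp.lapply m) (ket 0)

lemma continuous_dualWavefunction {g : P → Fin N → ℂ} (hg : ∀ j, Continuous fun u => g u j)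
    (β : ℂ) (m : Fin M → ℕ) : Continuous fun u => dualWavefunction (-1) β (g u) m := by
  simp only [dualWavefunction, List.ofFn_eq_map]
  exact IsContinuousFamily.list_prod hg β 1 0 _ (Finsupp.lapply 0) (ket m)

end Continuity

lemma eventually_add_mul_ne_zero {a b : ℂ} (h : a ≠ 0 ∨ b ≠ 0) :
    ∀ᶠ ε in nhdsWithin (0 : ℂ) {0}ᶜ, a + ε * b ≠ 0 := by
  by_cases ha : a = 0
  · filter_upwards [self_mem_nhdsWithin] with ε hε
    rw [ha, zero_add]
    exact mul_ne_zero hε (h.resolve_left (not_not.mpr ha))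
  · have hc : ContinuousAt (fun ε : ℂ => a + ε * b) 0 := by fun_prop
    exact (hc.eventually_ne (by simpa using ha)).filter_mono nhdsWithin_le_nhds

/-- An identity between functions of the spectral parameters that are continuous on lines through
`v` follows from the identity at generic parameters. -/
lemma eq_of_eq_on_generic {β : ℂ} {v : Fin N → ℂ} (hv : ∀ j, v j ≠ 0)
    (hvβ : ∀ j, 1 - β * v j ≠ 0) {F G : (Fin N → ℂ) → ℂ}
    (hF : ContinuousAt (fun ε : ℂ => F fun j => v j + ε * (j : ℂ)) 0)
    (hG : ContinuousAt (fun ε : ℂ => G fun j => v j + ε * (j : ℂ)) 0)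
    (h : ∀ w : Fin N → ℂ, Function.Injective w → (∀ j, w j ≠ 0) → (∀ i j, w i + w j ≠ 0) →
      (∀ j, 1 - β * w j ≠ 0) → F w = G w) : F v = G v := by
  have hne : ∀ᶠ ε in nhdsWithin (0 : ℂ) {0}ᶜ, (F fun j => v j + ε * (j : ℂ)) =
      G fun j => v j + ε * (j : ℂ) := by
    have h1 : ∀ᶠ ε in nhdsWithin (0 : ℂ) {0}ᶜ, ∀ j, v j + ε * (j : ℂ) ≠ 0 :=
      Filter.eventually_all.mpr fun j => eventually_add_mul_ne_zero (Or.inl (hv j))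
    have h2 : ∀ᶠ ε in nhdsWithin (0 : ℂ) {0}ᶜ, ∀ j, (1 - β * v j) + ε * (-β * (j : ℂ)) ≠ 0 :=
      Filter.eventually_all.mpr fun j => eventually_add_mul_ne_zero (Or.inl (hvβ j))
    have h3 : ∀ᶠ ε in nhdsWithin (0 : ℂ) {0}ᶜ, ∀ i j : Fin N,
        (v i + v j) + ε * ((i : ℂ) + (j : ℂ)) ≠ 0 :=
      Filter.eventually_all.mpr fun i => Filter.eventually_all.mpr fun j => by
        refine eventually_add_mul_ne_zero ?_
        -- The slope `i + j` vanishes only for `i = j = 0`, where the constant term is `2 v_0 ≠ 0`.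
        by_cases hij : (i : ℕ) + j = 0
        · left
          obtain rfl : i = j := Fin.ext (by omega)
          rw [← two_mul]
          exact mul_ne_zero two_ne_zero (hv i)
        · right
          exact_mod_cast hij
    -- The slopes `0, …, N-1` are distinct, so coinciding parameters separate.
    have h4 : ∀ᶠ ε in nhdsWithin (0 : ℂ) {0}ᶜ, ∀ i j : Fin N, i ≠ j →
        (v i - v j) + ε * ((i : ℂ) - (j : ℂ)) ≠ 0 :=
      Filter.eventually_all.mpr fun i => Filter.eventually_all.mpr fun j => by
        by_cases hij : i = j
        · simp [hij]
        · filter_upwards [eventually_add_mul_ne_zero (a := v i - v j) (b := (i : ℂ) - (j : ℂ))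
            (Or.inr (sub_ne_zero.mpr (by exact_mod_cast fun h => hij (Fin.ext h))))] with ε hε _
          exact hε
    filter_upwards [h1, h2, h3, h4] with ε h1 h2 h3 h4
    refine h _ (fun i j hij => ?_) h1 (fun i j => ?_) (fun j => ?_)
    · by_contra hne
      exact h4 i j hne (by linear_combination hij)
    · intro h'
      exact h3 i j (by linear_combination h')
    · intro h'
      exact h2 j (by linear_combination h')
  have := tendsto_nhds_unique_of_eventuallyEq (hF.mono_left nhdsWithin_le_nhds)
    (hG.mono_left nhdsWithin_le_nhds) hne
  simpa using this

/-! ## Schur polynomials -/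

lemma prod_sub_mul_schur (lam : Fin N → ℕ) (z : Fin N → ℂ) :
    (∏ j, ∏ k ∈ Finset.Ioi j, (z j - z k)) * schur lam z =
      (Matrix.of fun j k : Fin N => z j ^ (lam k + (N - ((k : ℕ) + 1)))).det := by
  have h := congrArg (MvPolynomial.eval z) (vandermondeProd_mul_schurPoly lam)
  rw [map_mul, vandermondeProd, alternant, RingHom.map_det] at h
  simp only [map_prod, map_sub, MvPolynomial.eval_X] at h
  rw [schur, h]
  congr 1
  ext j k
  simp

lemma continuousAt_schur {lam : Fin N → ℕ} {g : ℂ → Fin N → ℂ} {a : ℂ}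
    (hg : ∀ j, ContinuousAt (fun u => g u j) a) : ContinuousAt (fun u => schur lam (g u)) a :=
  (MvPolynomial.continuous_eval (schurPoly lam)).continuousAt.comp (continuousAt_pi.mpr hg)

/-- The parameter `z = (v⁻¹ - β)⁻¹`. -/
def zParam (β v : ℂ) : ℂ := (v⁻¹ - β)⁻¹

lemma zParam_eq (β : ℂ) {v : ℂ} (hv : v ≠ 0) : zParam β v = v / (1 - β * v) := by
  rw [zParam, inv_eq_one_div, ← mul_div_mul_right 1 _ hv, one_mul, sub_mul, inv_mul_cancel₀ hv]

lemma one_add_mul_zParam {β v : ℂ} (hv : v ≠ 0) (hvβ : 1 - β * v ≠ 0) :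
    1 + β * zParam β v = (1 - β * v)⁻¹ := by
  rw [zParam_eq β hv]
  field_simp
  ring

/-- Over the common denominator `(1-βv_j)(1-βv_k)`, the numerator of `z_j+z_k+2βz_jz_k` is `v_j+v_k`
and that of `z_j-z_k` is `v_j-v_k`. -/
lemma prod_add_eq_scatterProd_mul {β : ℂ} {v : Fin N → ℂ} (hinj : Function.Injective v)
    (hv : ∀ j, v j ≠ 0) (hvβ : ∀ j, 1 - β * v j ≠ 0) :
    ∏ j, ∏ k ∈ Finset.Ioi j, (zParam β (v j) + zParam β (v k) +
        2 * β * zParam β (v j) * zParam β (v k)) =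
      scatterProd v * ∏ j, ∏ k ∈ Finset.Ioi j, (zParam β (v j) - zParam β (v k)) := by
  simp only [scatterProd, ← Finset.prod_mul_distrib]
  refine Finset.prod_congr rfl fun j _ => Finset.prod_congr rfl fun k hk => ?_
  have hjk : v j - v k ≠ 0 := sub_ne_zero.mpr (hinj.ne (Finset.mem_Ioi.mp hk).ne)
  have h1 := hvβ j
  have h2 := hvβ k
  have hs : scatter (v j) (v k) * (v j - v k) = v j + v k := div_mul_cancel₀ _ hjk
  have ej : zParam β (v j) * (1 - β * v j) = v j := by
    rw [zParam_eq β (hv j), div_mul_cancel₀ _ h1]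
  have ek : zParam β (v k) * (1 - β * v k) = v k := by
    rw [zParam_eq β (hv k), div_mul_cancel₀ _ h2]
  apply mul_left_cancel₀ (mul_ne_zero h1 h2)
  linear_combination (1 - β * v k) * ej + (1 - β * v j) * ek +
    2 * β * (zParam β (v k) * (1 - β * v k)) * ej + 2 * β * v j * ek -
    scatter (v j) (v k) * ((1 - β * v k) * ej - (1 - β * v j) * ek) - hs

lemma continuousAt_zParam {β : ℂ} {f : ℂ → ℂ} {a : ℂ} (hf : ContinuousAt f a) (h0 : f a ≠ 0)
    (hβ : 1 - β * f a ≠ 0) : ContinuousAt (fun u => zParam β (f u)) a := by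
  refine ((hf.inv₀ h0).sub continuousAt_const).inv₀ ?_
  intro h
  apply hβ
  have h' : (f a)⁻¹ - β = 0 := h
  linear_combination f a * h' - mul_inv_cancel₀ h0

lemma continuousAt_pairing {β : ℂ} {g : ℂ → Fin N → ℂ} {a : ℂ}
    (hg : ∀ j, ContinuousAt (fun u => zParam β (g u j)) a) : ContinuousAt (fun u =>
      ∏ j, ∏ k ∈ Finset.Ioi j, (zParam β (g u j) + zParam β (g u k) +
        2 * β * zParam β (g u j) * zParam β (g u k))) a := by
  refine tendsto_finsetProd _ fun j _ => tendsto_finsetProd _ fun k _ => ?_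
  exact ((hg j).add (hg k)).add ((continuousAt_const.mul (hg j)).mul (hg k))

lemma continuousAt_denominator {β : ℂ} {g : ℂ → Fin N → ℂ} {a : ℂ}
    (hg : ∀ j, ContinuousAt (fun u => zParam β (g u j)) a) (n : ℕ) :
    ContinuousAt (fun u => ∏ j, (1 + β * zParam β (g u j)) ^ n) a :=
  tendsto_finsetProd _ fun j _ =>
    (continuousAt_const.add (continuousAt_const.mul (hg j))).pow n

end

end SixVertex

end

/-! ### From determinants to Schur polynomials -/

theorem mainTheorem2 (M N : ℕ) (β : ℂ) (v z : Fin N → ℂ)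
    (hv : ∀ j, v j ≠ 0) (hvβ : ∀ j, (v j)⁻¹ - β ≠ 0)
    (hz : ∀ j, z j = ((v j)⁻¹ - β)⁻¹)
    (m : Fin M → ℕ) (x lam : Fin N → ℕ)
    (hx : SixVertex.IsPositions m x) (hlam : SixVertex.IsShiftOf lam x) :
    SixVertex.wavefunction (-1) β v m =
        (2 ^ N * (∏ j, z j) * ∏ j, ∏ k ∈ Finset.Ioi j, (z j + z k + 2 * β * z j * z k)) /
          (∏ j, (1 + β * z j) ^ M) * SixVertex.schur lam z ∧
      SixVertex.dualWavefunction (-1) β v m =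
        (∏ j, ∏ k ∈ Finset.Ioi j, (z j + z k + 2 * β * z j * z k)) /
          (∏ j, (1 + β * z j) ^ (M - 1)) *
            SixVertex.schur (SixVertex.dualPartition M lam) z := by
  open SixVertex in
  obtain rfl : z = fun j => zParam β (v j) := funext hz
  obtain rfl : m = configuration M x := funext hx.count
  have hvβ' : ∀ j, 1 - β * v j ≠ 0 := fun j h => hvβ j (by
    linear_combination (v j)⁻¹ * h + β * mul_inv_cancel₀ (hv j))
  have hxs : StrictAnti x := fun i j hij => by
    have h1 := hlam.eq i
    have h2 := hlam.eq j
    have h3 := hlam.antitone hij.le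
    have h4 : (i : ℕ) < j := hij
    omega
  have hexp : ∀ k : Fin N, lam k + (N - ((k : ℕ) + 1)) = x k - 1 := fun k => by
    have h1 := hlam.eq k
    omega
  -- The largest part is `x_1 - N ≤ M - N`, so the truncated subtraction in `dualPartition` is
  -- exact.
  have hexp' : ∀ k : Fin N, dualPartition M lam k + (N - ((k : ℕ) + 1)) = M - x k.rev := fun k => by
    have h1 := hlam.eq k.rev
    have h0 := hlam.eq ⟨0, k.pos⟩
    have h2 := hlam.antitone (show (⟨0, k.pos⟩ : Fin N) ≤ k.rev from Nat.zero_le _)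
    have h3 := hx.le ⟨0, k.pos⟩
    have h4 := hx.le k.rev
    simp only [Fin.val_rev, dualPartition] at *
    omega
  have hline : ∀ j : Fin N, Continuous fun ε : ℂ => v j + ε * (j : ℂ) := fun j => by fun_prop
  have hzline : ∀ j : Fin N, ContinuousAt (fun ε : ℂ => zParam β (v j + ε * (j : ℂ))) 0 :=
    fun j => continuousAt_zParam (hline j).continuousAt (by simpa using hv j)
      (by simpa using hvβ' j)
  have hden : ∀ n, ∏ j, (1 + β * zParam β (v j + 0 * (j : ℂ))) ^ n ≠ 0 := fun n =>
    Finset.prod_ne_zero_iff.mpr fun j _ => pow_ne_zero _ (by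
      rw [zero_mul, add_zero, one_add_mul_zParam (hv j) (hvβ' j)]
      exact inv_ne_zero (hvβ' j))
  constructor
  · refine eq_of_eq_on_generic (F := fun w => wavefunction (-1) β w (configuration M x))
      (G := fun w => (2 ^ N * (∏ j, zParam β (w j)) * ∏ j, ∏ k ∈ Finset.Ioi j,
        (zParam β (w j) + zParam β (w k) + 2 * β * zParam β (w j) * zParam β (w k))) /
          (∏ j, (1 + β * zParam β (w j)) ^ M) * schur lam fun j => zParam β (w j))
      hv hvβ' (continuous_wavefunction hline β _).continuousAt ?_ ?_
    · exact (((continuousAt_const.mul (tendsto_finsetProd _ fun j _ => hzline j)).mul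
        (continuousAt_pairing hzline)).div (continuousAt_denominator hzline M) (hden M)).mul
        (continuousAt_schur hzline)
    · intro w hw hw0 hww hwβ
      rw [wavefunction_eq_det β hw hww hxs hx.one_le hx.le,
        prod_add_eq_scatterProd_mul hw hw0 hwβ]
      -- Row `i` has the common factor `2 z (1-βw)^M`, where `1-βw = (1+βz)⁻¹`; the powers `z^(x_j -
      -- 1)` remain.
      have hdet : (Matrix.of fun i j => 2 * (w i ^ x j * (1 - β * w i) ^ (M - x j))).det =
          (∏ i, 2 * zParam β (w i) * ((1 + β * zParam β (w i)) ^ M)⁻¹) * (Matrix.of fun i j =>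
            zParam β (w i) ^ (lam j + (N - ((j : ℕ) + 1)))).det := by
        rw [← Matrix.det_mul_column]
        congr 1
        ext i j
        have hi := hwβ i
        obtain ⟨y, hy⟩ := Nat.exists_eq_add_of_le' (hx.one_le j)
        obtain ⟨r, hr⟩ := Nat.exists_eq_add_of_le (hx.le j)
        simp only [Matrix.of_apply, hexp]
        rw [one_add_mul_zParam (hw0 i) hi, zParam_eq β (hw0 i), inv_pow, inv_inv, hr,
          Nat.add_sub_cancel_left, hy, Nat.add_sub_cancel, div_pow]
        field_simp
        ring
      rw [hdet, ← prod_sub_mul_schur, Finset.prod_mul_distrib, Finset.prod_mul_distrib,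
        Finset.prod_const, Finset.card_univ, Fintype.card_fin, Finset.prod_inv_distrib]
      ring
  · refine eq_of_eq_on_generic (F := fun w => dualWavefunction (-1) β w (configuration M x))
      (G := fun w => (∏ j, ∏ k ∈ Finset.Ioi j,
        (zParam β (w j) + zParam β (w k) + 2 * β * zParam β (w j) * zParam β (w k))) /
          (∏ j, (1 + β * zParam β (w j)) ^ (M - 1)) *
            schur (dualPartition M lam) fun j => zParam β (w j))
      hv hvβ' (continuous_dualWavefunction hline β _).continuousAt ?_ ?_
    · exact ((continuousAt_pairing hzline).div (continuousAt_denominator hzline (M - 1))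
        (hden (M - 1))).mul (continuousAt_schur hzline)
    · intro w hw hw0 hww hwβ
      rw [dualWavefunction_eq_det β hw hw0 hww hxs hx.one_le hx.le,
        prod_add_eq_scatterProd_mul hw hw0 hwβ]
      -- The two exponents add up to `M - 1`, hence the common row factor `(1-βw)^(M-1)`.
      have hdet : (Matrix.of fun i j => w i ^ (M - x (Fin.rev j)) *
            (1 - β * w i) ^ (x (Fin.rev j) - 1)).det =
          (∏ i, ((1 + β * zParam β (w i)) ^ (M - 1))⁻¹) * (Matrix.of fun i j : Fin N =>
            zParam β (w i) ^ (dualPartition M lam j + (N - ((j : ℕ) + 1)))).det := by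
        rw [← Matrix.det_mul_column]
        congr 1
        ext i j
        have hi := hwβ i
        have hM : M - 1 = (M - x j.rev) + (x j.rev - 1) := by
          have := hx.one_le j.rev
          have := hx.le j.rev
          omega
        simp only [Matrix.of_apply, hexp']
        rw [one_add_mul_zParam (hw0 i) hi, zParam_eq β (hw0 i), inv_pow, inv_inv, hM, div_pow,
          pow_add]
        field_simp
      rw [hdet, ← prod_sub_mul_schur, Finset.prod_inv_distrib]
      ring
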